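/- Let $\mathbb{D}=\{z\in\mathbb{C}:|z|<1\}$, let $D(\zeta,\delta)=\{z\in\mathbb{C}:|z-\zeta|<\delta\}$, let $A$ be an analytic function in $\mathbb{D}$, and let $\zeta\in\partial\mathbb{D}$. A non-trivial solution of $$f''+Af=0 \qquad (1)$$ is an analytic function $f$ in $\mathbb{D}$, not identically zero, that satisfies (1) in $\mathbb{D}$. (i) If there exists a sequence $\{w_n\}\subset\mathbb{D}$ converging to $\zeta$ such that $$|A(w_n)|(1-|w_n|^2)^2\to c \qquad (2)$$ for some $c\in(3,\infty]$, then for each $\delta>0$ there exists a non-trivial solution of (1) having two distinct zeros in $D(\zeta,\delta)\cap\mathbb{D}$. (ii) Conversely, if for each $\delta>0$ there exists a non-trivial solution of (1) having two distinct zeros in $D(\zeta,\delta)\cap\mathbb{D}$, then there exists a sequence $\{w_n\}\subset\mathbb{D}$ converging to $\zeta$ such that (2) holds for some $c\in[1,\infty]$. -/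

import Mathlib

/-- `f` is a non-trivial solution, analytic in the open unit disc, of `f'' + A f = 0` there.
As the disc is open, `deriv` at its points depends only on the values of `f` in the disc. -/
def IsNontrivialSolution (A f : ℂ → ℂ) : Prop :=
  DifferentiableOn ℂ f (Metric.ball 0 1) ∧
  (∀ z ∈ Metric.ball (0 : ℂ) 1, deriv (deriv f) z + A z * f z = 0) ∧
  ∃ z ∈ Metric.ball (0 : ℂ) 1, f z ≠ 0

/-- For every `δ > 0` some non-trivial solution of `f'' + A f = 0` (which may depend on `δ`)
has two distinct zeros in `D(ζ, δ) ∩ 𝔻`. -/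
def HasZeroPairsNear (A : ℂ → ℂ) (ζ : ℂ) : Prop :=
  ∀ δ : ℝ, 0 < δ → ∃ f : ℂ → ℂ, IsNontrivialSolution A f ∧
    ∃ z₁ ∈ Metric.ball ζ δ ∩ Metric.ball 0 1, ∃ z₂ ∈ Metric.ball ζ δ ∩ Metric.ball 0 1,
      z₁ ≠ z₂ ∧ f z₁ = 0 ∧ f z₂ = 0

/-- There is a sequence in the unit disc converging to `ζ` along which
`|A(w)| (1 - |w|²)²` tends to the extended real number `c`. -/
def HasBoundaryLimitAlongSeq (A : ℂ → ℂ) (ζ : ℂ) (c : EReal) : Prop :=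
  ∃ w : ℕ → ℂ, (∀ n, w n ∈ Metric.ball (0 : ℂ) 1) ∧
    Filter.Tendsto w Filter.atTop (nhds ζ) ∧
    Filter.Tendsto (fun n => ((‖A (w n)‖ * (1 - ‖w n‖ ^ 2) ^ 2 : ℝ) : EReal))
      Filter.atTop (nhds c)

/-! Both directions rest on conformal invariance. For an automorphism φ of the disc, (φ')^(-1/2) ·
f∘φ solves the equation with coefficient A(φ) φ'², so |A(z)|(1 - |z|²)² is preserved and any point
may be moved to the origin (`SolvesWithDeriv.comp_discAut`).

Large coefficient gives zeros (Kraus). If no solution has two zeros near ζ, the quotient of two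
independent solutions is injective on a hyperbolic disc around w, for w close to ζ. Pulled back to
the unit disc and normalized, its reciprocal is 1/u + H(u), with H'(0) equal to -1/3 of the
pulled-back coefficient at 0. The area theorem (`norm_deriv_le_of_injOn`) gives |H'(0)| ≤ 1, hence
the constant 3. Letting the radius of the hyperbolic disc tend to 1 contradicts a limit above 3.

Zeros give a large coefficient. Two zeros near ζ are joined by a hyperbolic geodesic. If |A(z)|(1 -
|z|²)² < 1 along it, comparison with y'' + (1 - x²)^(-2) y = 0 makes the solution vanish on the
geodesic (`eq_zero_of_norm_coeff_lt`), hence identically. The geodesic stays near ζ because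
hyperbolic half-planes are convex (`norm_sub_discAut_lt`). -/

open ComplexConjugate MeasureTheory

/-! ### Power series on the unit disc and the series solution of the equation -/

/-- The coefficients `c n` grow slowly enough for `∑ c n * z ^ n` to converge on the open
unit disc. -/
def SubexpGrowth (c : ℕ → ℂ) : Prop :=
  ∀ ρ : ℝ, 0 < ρ → ρ < 1 → ∃ K : ℝ, ∀ n, ‖c n‖ * ρ ^ n ≤ K

/-- The coefficients of the formal derivative of `∑ c n * z ^ n`. -/
def derivCoeff (c : ℕ → ℂ) (n : ℕ) : ℂ := (n + 1) * c (n + 1)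

/-- The sum of the power series with coefficients `c`. -/
noncomputable def powerSum (c : ℕ → ℂ) (z : ℂ) : ℂ := ∑' n, c n * z ^ n

theorem SubexpGrowth.summable {c : ℕ → ℂ} (hc : SubexpGrowth c) {r : ℝ} (h0 : 0 ≤ r)
    (h1 : r < 1) : Summable fun n => ‖c n‖ * r ^ n := by
  obtain ⟨ρ, hρ, hρ1⟩ := exists_between h1
  have hρ0 : 0 < ρ := h0.trans_lt hρ
  obtain ⟨K, hK⟩ := hc ρ hρ0 hρ1
  have hg : Summable fun n : ℕ => K * (r / ρ) ^ n :=
    (summable_geometric_of_lt_one (by positivity) ((div_lt_one hρ0).2 hρ)).mul_left K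
  refine Summable.of_nonneg_of_le (fun n => by positivity) (fun n => ?_) hg
  calc ‖c n‖ * r ^ n = (‖c n‖ * ρ ^ n) * (r / ρ) ^ n := by
        rw [div_pow]; field_simp
    _ ≤ K * (r / ρ) ^ n := by gcongr; exact hK n

theorem SubexpGrowth.summable_norm {c : ℕ → ℂ} (hc : SubexpGrowth c) {z : ℂ}
    (hz : z ∈ Metric.ball (0 : ℂ) 1) : Summable fun n => ‖c n * z ^ n‖ := by
  simpa [norm_mul, norm_pow] using hc.summable (norm_nonneg z) (by simpa using hz)

/-- For ρ < r < 1 the extra factor n is absorbed by the bounded sequence n (ρ/r)^n. -/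
theorem SubexpGrowth.derivCoeff {c : ℕ → ℂ} (hc : SubexpGrowth c) :
    SubexpGrowth (derivCoeff c) := by
  intro ρ h0 h1
  obtain ⟨r, hρr, hr1⟩ := exists_between h1
  have hr0 : 0 < r := h0.trans hρr
  obtain ⟨K, hK⟩ := hc r hr0 hr1
  have hq0 : 0 < ρ / r := by positivity
  have hq : ρ / r < 1 := (div_lt_one hr0).2 hρr
  obtain ⟨M, hM⟩ := (tendsto_self_mul_const_pow_of_lt_one hq0.le hq).bddAbove_range
  have hM' : ∀ n : ℕ, (n : ℝ) * (ρ / r) ^ n ≤ M := fun n => hM ⟨n, rfl⟩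
  have hK0 : 0 ≤ K := le_trans (by positivity) (hK 0)
  refine ⟨K * M / ρ, fun n => ?_⟩
  have e : ‖_root_.derivCoeff c n‖ * ρ ^ n
      = (‖c (n + 1)‖ * r ^ (n + 1)) * (((n + 1 : ℕ) : ℝ) * (ρ / r) ^ (n + 1)) / ρ := by
    have : ‖((n : ℂ) + 1)‖ = (n : ℝ) + 1 := by
      exact_mod_cast Complex.norm_natCast (n + 1)
    rw [_root_.derivCoeff, norm_mul, this, div_pow]
    push_cast
    field_simp
    ring
  rw [e]
  have := mul_le_mul (hK (n + 1)) (hM' (n + 1)) (by positivity) hK0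
  gcongr

theorem SubexpGrowth.hasDerivAt_powerSum {c : ℕ → ℂ} (hc : SubexpGrowth c) {z : ℂ}
    (hz : z ∈ Metric.ball (0 : ℂ) 1) :
    HasDerivAt (powerSum c) (powerSum (_root_.derivCoeff c) z) z := by
  have hz1 : ‖z‖ < 1 := by simpa using hz
  obtain ⟨r, hzr, hr1⟩ := exists_between hz1
  have hr0 : 0 ≤ r := (norm_nonneg z).trans hzr.le
  have hsum := hc.summable hr0 hr1
  have hd : ∀ n : ℕ, DifferentiableOn ℂ (fun w : ℂ => c n * w ^ n) (Metric.ball 0 r) :=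
    fun n => by fun_prop
  have hle : ∀ (n : ℕ) (w : ℂ), w ∈ Metric.ball (0 : ℂ) r → ‖c n * w ^ n‖ ≤ ‖c n‖ * r ^ n := by
    intro n w hw
    have : ‖w‖ < r := by simpa using hw
    rw [norm_mul, norm_pow]
    gcongr
  have hzb : z ∈ Metric.ball (0 : ℂ) r := by simpa using hzr
  have h1 := Complex.hasSum_deriv_of_summable_norm hsum hd Metric.isOpen_ball hle hzb
  have h2 := (Complex.differentiableOn_tsum_of_summable_norm hsum hd Metric.isOpen_ball
    hle).differentiableAt (Metric.isOpen_ball.mem_nhds hzb)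
  have h3 : HasSum (fun n => _root_.derivCoeff c n * z ^ n)
      (deriv (fun w : ℂ => ∑' n, c n * w ^ n) z) := by
    -- The index shift drops the constant term, whose derivative is 0.
    have h := (hasSum_nat_add_iff' 1).2 h1
    have e : ∀ n : ℕ, deriv (fun w : ℂ => c (n + 1) * w ^ (n + 1)) z
        = _root_.derivCoeff c n * z ^ n := fun n => by
      simp [_root_.derivCoeff]
      ring
    simpa [e] using h
  have h4 := h2.hasDerivAt
  rw [← h3.tsum_eq] at h4
  exact h4

/-- The Taylor coefficients of the solution of `f'' + A f = 0` with `f 0 = p`, `f' 0 = q`,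
where `A = ∑ a n * z ^ n`. -/
noncomputable def solutionCoeff (a : ℕ → ℂ) (p q : ℂ) : ℕ → ℂ
  | 0 => p
  | 1 => q
  | n + 2 => -(∑ k : Fin (n + 1), solutionCoeff a p q k * a (n - k)) / ((n + 1) * (n + 2))
decreasing_by exact Nat.lt_succ_of_lt k.2

theorem solutionCoeff_add_two (a : ℕ → ℂ) (p q : ℂ) (n : ℕ) :
    ((n : ℂ) + 1) * ((n : ℂ) + 2) * solutionCoeff a p q (n + 2)
      = -∑ k ∈ Finset.range (n + 1), solutionCoeff a p q k * a (n - k) := by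
  rw [solutionCoeff, ← Fin.sum_univ_eq_sum_range (fun k => solutionCoeff a p q k * a (n - k))]
  have h1 : (n : ℂ) + 1 ≠ 0 := by exact_mod_cast Nat.succ_ne_zero n
  have h2 : (n : ℂ) + 2 ≠ 0 := by exact_mod_cast Nat.succ_ne_zero (n + 1)
  field_simp

/-- With S = ∑ |a n| ρ^n, the recursion bounds (m + 1)(m + 2) |c (m + 2)| ρ^m by K S whenever K
bounds the earlier terms. Once m ≥ S the polynomial factor beats S, so the K that covers the first
finitely many terms covers all of them. -/
theorem subexpGrowth_solutionCoeff {a : ℕ → ℂ} (ha : SubexpGrowth a) (p q : ℂ) :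
    SubexpGrowth (solutionCoeff a p q) := by
  intro ρ h0 h1
  set c := solutionCoeff a p q with hcdef
  have hs := ha.summable h0.le h1
  set S := ∑' n, ‖a n‖ * ρ ^ n with hS
  have hS0 : 0 ≤ S := tsum_nonneg fun n => by positivity
  obtain ⟨N, hN⟩ := exists_nat_ge S
  set K := ∑ j ∈ Finset.range (N + 2), ‖c j‖ * ρ ^ j with hKdef
  have hK0 : 0 ≤ K := Finset.sum_nonneg fun n _ => by positivity
  refine ⟨K, fun n => ?_⟩
  induction n using Nat.strong_induction_on with
  | _ n ih =>
    by_cases hn : n < N + 2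
    · exact Finset.single_le_sum (f := fun j => ‖c j‖ * ρ ^ j) (fun j _ => by positivity)
        (Finset.mem_range.2 hn)
    · obtain ⟨m, rfl⟩ : ∃ m, n = m + 2 := ⟨n - 2, by omega⟩
      have hm : (N : ℝ) ≤ m := by exact_mod_cast (by omega : N ≤ m)
      have hrec := congrArg norm (solutionCoeff_add_two a p q m)
      rw [norm_neg, norm_mul, norm_mul] at hrec
      have n1 : ‖((m : ℂ) + 1)‖ = (m : ℝ) + 1 := by
        exact_mod_cast Complex.norm_natCast (m + 1)
      have n2 : ‖((m : ℂ) + 2)‖ = (m : ℝ) + 2 := by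
        exact_mod_cast Complex.norm_natCast (m + 2)
      rw [n1, n2, ← hcdef] at hrec
      have hbound : ‖∑ k ∈ Finset.range (m + 1), c k * a (m - k)‖ * ρ ^ m ≤ K * S := by
        calc ‖∑ k ∈ Finset.range (m + 1), c k * a (m - k)‖ * ρ ^ m
            ≤ (∑ k ∈ Finset.range (m + 1), ‖c k * a (m - k)‖) * ρ ^ m := by
              gcongr; exact norm_sum_le _ _
          _ = ∑ k ∈ Finset.range (m + 1), (‖c k‖ * ρ ^ k) * (‖a (m - k)‖ * ρ ^ (m - k)) := by
              rw [Finset.sum_mul]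
              refine Finset.sum_congr rfl fun k hk => ?_
              have hk' : k + (m - k) = m := by have := Finset.mem_range.1 hk; omega
              have : ρ ^ m = ρ ^ k * ρ ^ (m - k) := by rw [← pow_add, hk']
              rw [norm_mul, this]; ring
          _ ≤ ∑ k ∈ Finset.range (m + 1), K * (‖a (m - k)‖ * ρ ^ (m - k)) := by
              refine Finset.sum_le_sum fun k hk => ?_
              have := ih k (by have := Finset.mem_range.1 hk; omega)
              gcongr
          _ = K * ∑ k ∈ Finset.range (m + 1), ‖a k‖ * ρ ^ k := by
              rw [← Finset.mul_sum, ← Finset.sum_range_reflect (fun k => ‖a k‖ * ρ ^ k)]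
              simp
          _ ≤ K * S := by
              gcongr
              exact hs.sum_le_tsum _ fun n _ => by positivity
      rw [← hrec] at hbound
      have hc0 : 0 ≤ ‖c (m + 2)‖ * ρ ^ m := by positivity
      have h5 : (m + 1) * (‖c (m + 2)‖ * ρ ^ m) ≤ (m + 1) * K := by
        calc (m + 1) * (‖c (m + 2)‖ * ρ ^ m)
            ≤ ((m : ℝ) + 1) * (m + 2) * ‖c (m + 2)‖ * ρ ^ m := by
              have : 0 ≤ ((m : ℝ) + 1) * (m + 1) * (‖c (m + 2)‖ * ρ ^ m) := by positivity
              linarith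
          _ ≤ K * S := hbound
          _ ≤ (m + 1) * K := by nlinarith
      have h6 : ‖c (m + 2)‖ * ρ ^ m ≤ K := le_of_mul_le_mul_left h5 (by positivity)
      calc ‖c (m + 2)‖ * ρ ^ (m + 2) = (‖c (m + 2)‖ * ρ ^ m) * ρ ^ 2 := by ring
        _ ≤ K * 1 := by
          gcongr
          exact pow_le_one₀ h0.le h1.le
        _ = K := mul_one K

/-- A function holomorphic on the unit disc is the sum of a power series there. -/
theorem exists_powerSum_eq {A : ℂ → ℂ} (hA : DifferentiableOn ℂ A (Metric.ball 0 1)) :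
    ∃ a : ℕ → ℂ, SubexpGrowth a ∧ ∀ z ∈ Metric.ball (0 : ℂ) 1, A z = powerSum a z := by
  refine ⟨fun n => ((n.factorial : ℂ))⁻¹ * iteratedDeriv n A 0, ?_, fun z hz => ?_⟩
  · intro ρ h0 h1
    -- The Taylor series converges at the point ρ itself, so its terms there are bounded.
    have hρ : (ρ : ℂ) ∈ Metric.ball (0 : ℂ) 1 := by simpa [abs_of_pos h0] using h1
    have hs := (Complex.hasSum_taylorSeries_on_ball hA hρ).summable
    obtain ⟨K, hK⟩ := hs.tendsto_atTop_zero.norm.bddAbove_range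
    refine ⟨K, fun n => le_trans (le_of_eq ?_) (hK ⟨n, rfl⟩)⟩
    simp [abs_of_pos h0]
    ring
  · rw [powerSum, ← Complex.taylorSeries_eq_on_ball' hz hA]
    simp

/-! ### Solutions, linear combinations and the Wronskian -/

/-- In the unit disc `f'` is the derivative of `f`, and `f` solves `f'' + A f = 0`. -/
def SolvesWithDeriv (A f f' : ℂ → ℂ) : Prop :=
  ∀ z ∈ Metric.ball (0 : ℂ) 1, HasDerivAt f (f' z) z ∧ HasDerivAt f' (-(A z * f z)) z

/-- The initial value problem at the origin for `f'' + A f = 0` in the unit disc. -/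
theorem exists_solution {A : ℂ → ℂ} (hA : DifferentiableOn ℂ A (Metric.ball 0 1)) (p q : ℂ) :
    ∃ f g : ℂ → ℂ, f 0 = p ∧ g 0 = q ∧ SolvesWithDeriv A f g := by
  obtain ⟨a, ha, hAa⟩ := exists_powerSum_eq hA
  have hc := subexpGrowth_solutionCoeff ha p q
  set c := solutionCoeff a p q with hcdef
  have hzero : ∀ b : ℕ → ℂ, powerSum b 0 = b 0 := fun b => by
    rw [powerSum, tsum_eq_single 0 fun n hn => by simp [hn]]
    simp
  refine ⟨powerSum c, powerSum (derivCoeff c), ?_, ?_, fun z hz =>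
    ⟨hc.hasDerivAt_powerSum hz, ?_⟩⟩
  · rw [hzero, hcdef, solutionCoeff]
  · rw [hzero, derivCoeff, hcdef, solutionCoeff]; simp
  · have h := hc.derivCoeff.hasDerivAt_powerSum hz
    convert h using 1
    -- The Cauchy product turns the equation into the recursion that defines the coefficients.
    rw [hAa z hz, mul_comm, powerSum, powerSum,
      tsum_mul_tsum_eq_tsum_sum_range_of_summable_norm (hc.summable_norm hz) (ha.summable_norm hz),
      powerSum, ← tsum_neg]
    refine tsum_congr fun n => ?_
    have hrec := solutionCoeff_add_two a p q n
    rw [← hcdef] at hrec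
    have e : derivCoeff (derivCoeff c) n = (n + 1) * (n + 2) * c (n + 2) := by
      simp only [derivCoeff]; push_cast; ring
    rw [e, hrec, neg_mul, Finset.sum_mul]
    congr 1
    refine Finset.sum_congr rfl fun k hk => ?_
    have hk' : k + (n - k) = n := by have := Finset.mem_range.1 hk; omega
    have : z ^ n = z ^ k * z ^ (n - k) := by rw [← pow_add, hk']
    rw [this]; ring

theorem IsNontrivialSolution.solvesWithDeriv {A f : ℂ → ℂ} (hf : IsNontrivialSolution A f) :
    SolvesWithDeriv A f (deriv f) := by
  intro z hz
  have hnhds := Metric.isOpen_ball.mem_nhds hz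
  refine ⟨(hf.1.differentiableAt hnhds).hasDerivAt, ?_⟩
  have h := ((hf.1.deriv Metric.isOpen_ball).differentiableAt hnhds).hasDerivAt
  rwa [eq_neg_of_add_eq_zero_left (hf.2.1 z hz)] at h

namespace SolvesWithDeriv

variable {A f f' g g' : ℂ → ℂ}

theorem differentiableOn (hf : SolvesWithDeriv A f f') :
    DifferentiableOn ℂ f (Metric.ball 0 1) :=
  fun z hz => (hf z hz).1.differentiableAt.differentiableWithinAt

theorem deriv_deriv_add (hf : SolvesWithDeriv A f f') {z : ℂ} (hz : z ∈ Metric.ball (0 : ℂ) 1) :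
    deriv (deriv f) z + A z * f z = 0 := by
  have h : deriv f =ᶠ[nhds z] f' := by
    filter_upwards [Metric.isOpen_ball.mem_nhds hz] with y hy using (hf y hy).1.deriv
  rw [h.deriv_eq, (hf z hz).2.deriv, neg_add_cancel]

theorem linearCombination (hf : SolvesWithDeriv A f f') (hg : SolvesWithDeriv A g g') (α β : ℂ) :
    SolvesWithDeriv A (fun z => α * f z + β * g z) (fun z => α * f' z + β * g' z) := by
  intro z hz
  refine ⟨((hf z hz).1.const_mul α).add ((hg z hz).1.const_mul β),
    (((hf z hz).2.const_mul α).add ((hg z hz).2.const_mul β)).congr_deriv ?_⟩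
  ring

/-- The Wronskian of two solutions is constant. -/
theorem wronskian_eq (hf : SolvesWithDeriv A f f') (hg : SolvesWithDeriv A g g') {z : ℂ}
    (hz : z ∈ Metric.ball (0 : ℂ) 1) :
    f' z * g z - f z * g' z = f' 0 * g 0 - f 0 * g' 0 := by
  have hd : ∀ y ∈ Metric.ball (0 : ℂ) 1,
      HasDerivAt (fun z => f' z * g z - f z * g' z) 0 y := by
    intro y hy
    refine (((hf y hy).2.mul (hg y hy).1).sub ((hf y hy).1.mul (hg y hy).2)).congr_deriv ?_
    ring
  exact Metric.isOpen_ball.is_const_of_deriv_eq_zero (convex_ball (0 : ℂ) 1).isPreconnected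
    (fun y hy => (hd y hy).differentiableAt.differentiableWithinAt)
    (fun y hy => (hd y hy).deriv) hz (Metric.mem_ball_self one_pos)

end SolvesWithDeriv

/-! ### Disc automorphisms and conformal invariance of the equation -/

/-- The automorphism of the unit disc that sends `0` to `a`. -/
noncomputable def discAut (a u : ℂ) : ℂ := (a + u) / (1 + conj a * u)

theorem one_add_conj_mul_ne_zero {a u : ℂ} (ha : ‖a‖ < 1) (hu : ‖u‖ < 1) :
    1 + conj a * u ≠ 0 := by
  intro h
  have h1 : ‖conj a * u‖ = 1 := by
    rw [show conj a * u = -1 by linear_combination h]; simp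
  rw [norm_mul, Complex.norm_conj] at h1
  nlinarith [norm_nonneg a, norm_nonneg u]

theorem norm_sq_one_add_conj_mul_sub (a u : ℂ) :
    ‖1 + conj a * u‖ ^ 2 - ‖a + u‖ ^ 2 = (1 - ‖a‖ ^ 2) * (1 - ‖u‖ ^ 2) := by
  simp only [← Complex.normSq_eq_norm_sq, Complex.normSq_apply, Complex.add_re, Complex.add_im,
    Complex.mul_re, Complex.mul_im, Complex.conj_re, Complex.conj_im, Complex.one_re,
    Complex.one_im]
  ring

/-- Combined with `hasDerivAt_discAut`, this is equality in the Schwarz-Pick lemma: 1 - |φ|² =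
|φ'|(1 - |u|²). It is the source of the invariance of |A(z)|(1 - |z|²)². -/
theorem one_sub_norm_sq_discAut {a u : ℂ} (ha : ‖a‖ < 1) (hu : ‖u‖ < 1) :
    1 - ‖discAut a u‖ ^ 2 = (1 - ‖a‖ ^ 2) * (1 - ‖u‖ ^ 2) / ‖1 + conj a * u‖ ^ 2 := by
  have h := norm_ne_zero_iff.2 (one_add_conj_mul_ne_zero ha hu)
  rw [← norm_sq_one_add_conj_mul_sub, discAut, norm_div, div_pow, sub_div,
    div_self (pow_ne_zero 2 h)]

theorem norm_discAut_lt_one {a u : ℂ} (ha : ‖a‖ < 1) (hu : ‖u‖ < 1) : ‖discAut a u‖ < 1 := by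
  have h := norm_pos_iff.2 (one_add_conj_mul_ne_zero ha hu)
  have h1 : 0 < 1 - ‖a‖ ^ 2 := by nlinarith [norm_nonneg a]
  have h2 : 0 < 1 - ‖u‖ ^ 2 := by nlinarith [norm_nonneg u]
  have h3 : 0 < 1 - ‖discAut a u‖ ^ 2 := by
    rw [one_sub_norm_sq_discAut ha hu]; positivity
  nlinarith [norm_nonneg (discAut a u)]

theorem hasDerivAt_discAut {a u : ℂ} (ha : ‖a‖ < 1) (hu : ‖u‖ < 1) :
    HasDerivAt (discAut a) (((1 - ‖a‖ ^ 2 : ℝ) : ℂ) / (1 + conj a * u) ^ 2) u := by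
  have h := one_add_conj_mul_ne_zero ha hu
  have h1 : HasDerivAt (fun u : ℂ => a + u) 1 u := (hasDerivAt_id u).const_add a
  have h2 : HasDerivAt (fun u : ℂ => 1 + conj a * u) (conj a) u := by
    simpa using ((hasDerivAt_id u).const_mul (conj a)).const_add 1
  refine (h1.div h2 h).congr_deriv ?_
  have : ((1 - ‖a‖ ^ 2 : ℝ) : ℂ) = 1 - a * conj a := by
    rw [Complex.mul_conj, Complex.normSq_eq_norm_sq]; push_cast; ring
  rw [this]
  congr 1
  ring

/-- Change of variables by a disc automorphism in `f'' + A f = 0`. -/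
theorem SolvesWithDeriv.comp_discAut {A f f' : ℂ → ℂ} (hf : SolvesWithDeriv A f f') {a c : ℂ}
    (ha : ‖a‖ < 1) (hc : ‖c‖ ≤ 1) :
    SolvesWithDeriv
      (fun u => A (discAut a (c * u))
        * (c * ((1 - ‖a‖ ^ 2 : ℝ) : ℂ) / (1 + conj a * (c * u)) ^ 2) ^ 2)
      (fun u => (1 + conj a * (c * u)) * f (discAut a (c * u)))
      (fun u => conj a * c * f (discAut a (c * u))
        + c * ((1 - ‖a‖ ^ 2 : ℝ) : ℂ) * f' (discAut a (c * u)) / (1 + conj a * (c * u))) := by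
  intro u hu
  have hcu : ‖c * u‖ < 1 := by
    rw [norm_mul]
    have : ‖u‖ < 1 := by simpa using hu
    nlinarith [norm_nonneg u, norm_nonneg c]
  have hball : discAut a (c * u) ∈ Metric.ball (0 : ℂ) 1 := by
    simpa using norm_discAut_lt_one ha hcu
  have hne := one_add_conj_mul_ne_zero ha hcu
  have hlin : HasDerivAt (fun u : ℂ => c * u) c u := by
    simpa using (hasDerivAt_id u).const_mul c
  have hden : HasDerivAt (fun u : ℂ => 1 + conj a * (c * u)) (conj a * c) u :=
    (hlin.const_mul (conj a)).const_add 1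
  have hφ := (hasDerivAt_discAut ha hcu).comp u hlin
  have h1 := (hf _ hball).1.comp u hφ
  have h2 := (hf _ hball).2.comp u hφ
  simp only [Function.comp_def] at h1 h2
  -- The factor 1 + conj a * (c * u) is a constant multiple of (φ')^(-1/2), so the first-order term
  -- cancels. No further zeroth-order term arises because a Möbius map has zero Schwarzian.
  refine ⟨(hden.mul h1).congr_deriv ?_, ((h1.const_mul (conj a * c)).add
    ((h2.const_mul (c * ((1 - ‖a‖ ^ 2 : ℝ) : ℂ))).div hden hne)).congr_deriv ?_⟩
  · beta_reduce
    generalize 1 + conj a * (c * u) = D at hne ⊢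
    field_simp
  · beta_reduce
    generalize 1 + conj a * (c * u) = D at hne ⊢
    field_simp
    ring

/-! ### Hyperbolic geodesics and half-planes -/

/-- Any two points of the unit disc are joined by a geodesic `x ↦ discAut a (e * x)`. -/
theorem exists_discAut_eq {a b : ℂ} (ha : ‖a‖ < 1) (hb : ‖b‖ < 1) (hab : a ≠ b) :
    ∃ (e : ℂ) (r : ℝ), ‖e‖ = 1 ∧ 0 < r ∧ r < 1 ∧ discAut a (e * r) = b := by
  have hna : ‖-a‖ < 1 := by rwa [norm_neg]
  -- `discAut (-a)` inverts `discAut a`; e and r are the polar coordinates of u.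
  set u := discAut (-a) b with hu
  have hu1 : ‖u‖ < 1 := norm_discAut_lt_one hna hb
  have hden := one_add_conj_mul_ne_zero hna hb
  have hden2 := one_add_conj_mul_ne_zero ha hu1
  have hu0 : u ≠ 0 := by
    rw [hu, discAut]
    refine div_ne_zero (fun h => hab ?_) hden
    linear_combination -h
  have hn : (‖u‖ : ℂ) ≠ 0 := by exact_mod_cast norm_ne_zero_iff.2 hu0
  refine ⟨u / ‖u‖, ‖u‖, ?_, norm_pos_iff.2 hu0, hu1, ?_⟩
  · rw [norm_div, Complex.norm_real, norm_norm, div_self (norm_ne_zero_iff.2 hu0)]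
  · rw [div_mul_cancel₀ _ hn, discAut, div_eq_iff hden2]
    have h1 : u * (1 + conj (-a) * b) = -a + b := by rw [hu, discAut, div_mul_cancel₀ _ hden]
    rw [map_neg] at h1
    linear_combination h1

/-- The set `‖z - ζ‖ ^ 2 < ε * (1 + ‖z‖ ^ 2)`, where `‖ζ‖ = 1`, is hyperbolically convex. -/
theorem norm_sub_discAut_lt {ζ a e : ℂ} {ε r x : ℝ} (hζ : ‖ζ‖ = 1) (ha : ‖a‖ < 1) (he : ‖e‖ = 1)
    (hx0 : 0 ≤ x) (hxr : x ≤ r) (hr : r < 1)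
    (h0 : ‖a - ζ‖ ^ 2 < ε * (1 + ‖a‖ ^ 2))
    (h1 : ‖discAut a (e * r) - ζ‖ ^ 2 < ε * (1 + ‖discAut a (e * r)‖ ^ 2)) :
    ‖discAut a (e * x) - ζ‖ ^ 2 < ε * (1 + ‖discAut a (e * x)‖ ^ 2) := by
  -- After clearing the denominator, the defect is a quadratic in y with equal outer coefficients,
  -- since |1 - ζ conj a| = |a - ζ| for |ζ| = 1. For ε < 1 this reflects that the set is cut out by
  -- a circle orthogonal to the unit circle.
  obtain ⟨k, hk⟩ : ∃ k : ℝ, ∀ y : ℝ, ‖a + e * y - ζ * (1 + conj a * (e * y))‖ ^ 2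
      - ε * (‖1 + conj a * (e * y)‖ ^ 2 + ‖a + e * y‖ ^ 2)
      = (‖a - ζ‖ ^ 2 - ε * (1 + ‖a‖ ^ 2)) * (1 + y ^ 2) + k * y := by
    have hζ' : ζ.re * ζ.re + ζ.im * ζ.im = 1 := by
      rw [← Complex.normSq_apply, Complex.normSq_eq_norm_sq, hζ, one_pow]
    have he' : e.re * e.re + e.im * e.im = 1 := by
      rw [← Complex.normSq_apply, Complex.normSq_eq_norm_sq, he, one_pow]
    refine ⟨2 * ((a - ζ) * conj (e - ζ * conj a * e)).re - 4 * ε * (conj a * e).re, fun y => ?_⟩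
    simp only [← Complex.normSq_eq_norm_sq, Complex.normSq_apply, Complex.add_re, Complex.add_im,
      Complex.sub_re, Complex.sub_im, Complex.ofReal_re, Complex.ofReal_im,
      Complex.mul_re, Complex.mul_im, Complex.conj_re, Complex.conj_im, Complex.one_re,
      Complex.one_im]
    linear_combination
      (y ^ 2 * ((1 + a.re * a.re + a.im * a.im) * (1 - ε)
        - 2 * (ζ.re * a.re + ζ.im * a.im)) + y ^ 2 * (a.re * a.re + a.im * a.im)
          * (ζ.re * ζ.re + ζ.im * ζ.im - 1)) * he'
      + y ^ 2 * (a.re * a.re + a.im * a.im - 1) * hζ'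
  have key : ∀ y : ℝ, 0 ≤ y → y < 1 →
      (‖discAut a (e * y) - ζ‖ ^ 2 < ε * (1 + ‖discAut a (e * y)‖ ^ 2) ↔
        (‖a - ζ‖ ^ 2 - ε * (1 + ‖a‖ ^ 2)) * (1 + y ^ 2) + k * y < 0) := by
    intro y hy0 hy1
    have hu : ‖e * y‖ < 1 := by
      rwa [norm_mul, he, one_mul, Complex.norm_real, Real.norm_of_nonneg hy0]
    have hd := one_add_conj_mul_ne_zero ha hu
    have hd' := norm_pos_iff.2 hd
    have e1 : discAut a (e * y) - ζ
        = (a + e * y - ζ * (1 + conj a * (e * y))) / (1 + conj a * (e * y)) := by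
      rw [discAut, sub_div, mul_div_cancel_right₀ _ hd]
    rw [← hk, e1, discAut, norm_div, norm_div, div_pow, div_pow, div_lt_iff₀ (by positivity),
      sub_neg]
    have e2 : ε * (1 + ‖a + e * y‖ ^ 2 / ‖1 + conj a * (e * y)‖ ^ 2)
        * ‖1 + conj a * (e * y)‖ ^ 2
        = ε * (‖1 + conj a * (e * y)‖ ^ 2 + ‖a + e * y‖ ^ 2) := by
      rw [mul_assoc, add_mul, one_mul, div_mul_cancel₀ _ (pow_ne_zero 2 hd'.ne')]
    rw [e2]
  rw [key r (hx0.trans hxr) hr] at h1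
  rw [key x hx0 (hxr.trans_lt hr)]
  have h0' : ‖a - ζ‖ ^ 2 - ε * (1 + ‖a‖ ^ 2) < 0 := by linarith
  set c := ‖a - ζ‖ ^ 2 - ε * (1 + ‖a‖ ^ 2)
  rcases le_or_gt k 0 with hk0 | hk0
  · nlinarith [sq_nonneg x]
  · rcases hx0.eq_or_lt with rfl | hx
    · simpa using h0'
    have hr0 : 0 < r := hx.trans_le hxr
    -- As c < 0, the function c (y + 1/y) + k increases on (0, 1); this compares its values at x ≤
    -- r, cleared of denominators.
    have h2 : r * (c * (1 + x ^ 2) + k * x) ≤ x * (c * (1 + r ^ 2) + k * r) := by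
      have : 0 ≤ (r - x) * (1 - r * x) := mul_nonneg (by linarith) (by nlinarith)
      nlinarith
    have h3 : r * (c * (1 + x ^ 2) + k * x) < 0 := h2.trans_lt (by nlinarith)
    nlinarith

/-! ### Zeros force a large coefficient: disconjugacy along a geodesic -/

/-- The equation `g'' + B g = 0` is disconjugate on `[0, r] ⊆ [0, 1)` if
`‖B x‖ < (1 - x ^ 2)⁻²`. -/
theorem eq_zero_of_norm_coeff_lt {g g' B : ℝ → ℂ} {r : ℝ} (hr : r < 1)
    (hg : ∀ x ∈ Set.Icc 0 r, HasDerivAt g (g' x) x)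
    (hg' : ∀ x ∈ Set.Icc 0 r, HasDerivAt g' (-(B x * g x)) x)
    (hB : ∀ x ∈ Set.Icc 0 r, ‖B x‖ * (1 - x ^ 2) ^ 2 < 1)
    (h0 : g 0 = 0) (h1 : g r = 0) {x : ℝ} (hx : x ∈ Set.Ioo 0 r) : g x = 0 := by
  -- The weight h = x / (1 - x²) is -y'/y for the comparison solution y = (1 - x²)^(1/2), so h' = h²
  -- + (1 - x²)^(-2). Completing the square in W' leaves |g' + h g|² plus a term at least ((1 -
  -- x²)^(-2) - |B|) |g|². Thus W is monotone, and it vanishes at both ends.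
  set W : ℝ → ℝ := fun x => inner ℝ (g x) (g' x) + x / (1 - x ^ 2) * inner ℝ (g x) (g x) with hW
  have hpos : ∀ x ∈ Set.Icc 0 r, 0 < 1 - x ^ 2 := fun x hx => by
    nlinarith [hx.1, hx.2]
  have hderiv : ∀ x ∈ Set.Icc 0 r, ∃ d, HasDerivAt W d x ∧
      (1 / (1 - x ^ 2) ^ 2 - ‖B x‖) * ‖g x‖ ^ 2 ≤ d := by
    intro x hx
    have hp := hpos x hx
    have hh : HasDerivAt (fun x : ℝ => x / (1 - x ^ 2)) ((1 + x ^ 2) / (1 - x ^ 2) ^ 2) x := by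
      have h2 : HasDerivAt (fun x : ℝ => 1 - x ^ 2) (-(2 * x)) x := by
        simpa using (hasDerivAt_pow 2 x).const_sub 1
      refine ((hasDerivAt_id x).div h2 hp.ne').congr_deriv ?_
      simp only [id]
      congr 1
      ring
    refine ⟨_, ((hg x hx).inner ℝ (hg' x hx)).add (hh.mul ((hg x hx).inner ℝ (hg x hx))), ?_⟩
    have hc : -(‖B x‖ * ‖g x‖ ^ 2) ≤ inner ℝ (g x) (-(B x * g x)) := by
      have := abs_real_inner_le_norm (g x) (-(B x * g x))
      rw [norm_neg, norm_mul] at this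
      have := (abs_le.1 this).1
      nlinarith
    have hsq := real_inner_self_nonneg (x := g' x + (x / (1 - x ^ 2)) • g x)
    rw [inner_add_add_self, real_inner_smul_left, real_inner_smul_left, real_inner_smul_right,
      real_inner_smul_right, real_inner_comm] at hsq
    have hgg : inner ℝ (g x) (g x) = ‖g x‖ ^ 2 := real_inner_self_eq_norm_sq _
    rw [hgg] at hsq ⊢
    have e : (1 + x ^ 2) / (1 - x ^ 2) ^ 2 = 1 / (1 - x ^ 2) ^ 2 + (x / (1 - x ^ 2)) ^ 2 := by
      rw [div_pow]; field_simp
    rw [e, real_inner_comm (g x) (g' x)]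
    rw [real_inner_comm (g x) (g' x)] at hsq
    nlinarith
  choose! d hd hdle using hderiv
  have hcoef : ∀ x ∈ Set.Icc 0 r, 0 < 1 / (1 - x ^ 2) ^ 2 - ‖B x‖ := fun x hx => by
    have hp := hpos x hx
    rw [sub_pos, lt_div_iff₀ (by positivity)]
    exact hB x hx
  have hmono : MonotoneOn W (Set.Icc 0 r) := by
    refine monotoneOn_of_hasDerivWithinAt_nonneg (convex_Icc 0 r)
      (fun x hx => (hd x hx).continuousAt.continuousWithinAt)
      (fun x hx => (hd x (interior_subset hx)).hasDerivWithinAt)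
      (fun x hx => le_trans ?_ (hdle x (interior_subset hx)))
    have := hcoef x (interior_subset hx)
    positivity
  have hr0 : 0 ≤ r := (hx.1.trans hx.2).le
  have hWzero : ∀ y ∈ Set.Ioo 0 r, W y = 0 := fun y hy => by
    have hy' := Set.Ioo_subset_Icc_self hy
    have e0 : W 0 = 0 := by simp [hW, h0]
    have e1 : W r = 0 := by simp [hW, h1]
    exact le_antisymm (e1 ▸ hmono hy' (Set.right_mem_Icc.2 hr0) hy'.2)
      (e0 ▸ hmono (Set.left_mem_Icc.2 hr0) hy' hy'.1)
  have hx' := Set.Ioo_subset_Icc_self hx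
  have hd0 : d x = 0 := by
    refine (hd x hx').unique ((hasDerivAt_const x (0 : ℝ)).congr_of_eventuallyEq ?_)
    filter_upwards [isOpen_Ioo.mem_nhds hx] with y hy using hWzero y hy
  have h2 := hdle x hx'
  rw [hd0] at h2
  have h3 := hcoef x hx'
  have h4 : ‖g x‖ ^ 2 ≤ 0 := by
    by_contra! h
    nlinarith [mul_pos h3 h]
  have h5 : ‖g x‖ = 0 := by nlinarith [norm_nonneg (g x)]
  exact norm_eq_zero.1 h5

/-- Between two zeros close to a boundary point the coefficient is large somewhere. -/
theorem IsNontrivialSolution.exists_one_le_norm_coeff {A f : ℂ → ℂ} (hf : IsNontrivialSolution A f)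
    {ζ a b : ℂ} {δ : ℝ} (hζ : ‖ζ‖ = 1) (ha : ‖a‖ < 1) (hb : ‖b‖ < 1) (hab : a ≠ b)
    (haζ : ‖a - ζ‖ < δ) (hbζ : ‖b - ζ‖ < δ) (hfa : f a = 0) (hfb : f b = 0) :
    ∃ w, ‖w‖ < 1 ∧ ‖w - ζ‖ ^ 2 < 2 * δ ^ 2 ∧ 1 ≤ ‖A w‖ * (1 - ‖w‖ ^ 2) ^ 2 := by
  have hsol := hf.solvesWithDeriv
  obtain ⟨hfd, -, z₀, hz₀, hfz₀⟩ := hf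
  obtain ⟨e, r, he, hr0, hr1, hφr⟩ := exists_discAut_eq ha hb hab
  set φ : ℝ → ℂ := fun x => discAut a (e * x) with hφ
  have hnorm : ∀ x ∈ Set.Icc 0 r, ‖e * (x : ℂ)‖ = x := fun x hx => by
    rw [norm_mul, he, one_mul, Complex.norm_real, Real.norm_of_nonneg hx.1]
  have hlt : ∀ x ∈ Set.Icc 0 r, ‖e * (x : ℂ)‖ < 1 := fun x hx => by
    rw [hnorm x hx]; exact hx.2.trans_lt hr1
  have hφball : ∀ x ∈ Set.Icc 0 r, φ x ∈ Metric.ball (0 : ℂ) 1 := fun x hx => by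
    simpa using norm_discAut_lt_one ha (hlt x hx)
  have hδ : 0 < δ := (norm_nonneg _).trans_lt haζ
  -- The ball D(ζ, δ) is enlarged to a hyperbolically convex set with ε = δ²; the bound 1 + |z|² ≤ 2
  -- then gives the factor 2 in the conclusion.
  have hsq : ∀ z : ℂ, ‖z - ζ‖ < δ → ‖z - ζ‖ ^ 2 < δ ^ 2 * (1 + ‖z‖ ^ 2) := fun z hz => by
    have : ‖z - ζ‖ ^ 2 < δ ^ 2 := by gcongr
    nlinarith [sq_nonneg (δ * ‖z‖)]
  have hφζ : ∀ x ∈ Set.Icc 0 r, ‖φ x - ζ‖ ^ 2 < 2 * δ ^ 2 := fun x hx => by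
    have h := norm_sub_discAut_lt (ε := δ ^ 2) hζ ha he hx.1 hx.2 hr1 (hsq a haζ)
      (by rw [hφr]; exact hsq b hbζ)
    have h1 : ‖φ x‖ < 1 := by simpa using hφball x hx
    have h2 : ‖φ x‖ ^ 2 ≤ 1 := pow_le_one₀ (norm_nonneg _) h1.le
    refine h.trans_le ?_
    nlinarith [mul_le_mul_of_nonneg_left h2 (sq_nonneg δ)]
  by_contra! hcon
  set D : ℝ → ℂ := fun x => 1 + conj a * (e * x) with hD
  set m : ℂ := e * ((1 - ‖a‖ ^ 2 : ℝ) : ℂ) with hm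
  have hDne : ∀ x ∈ Set.Icc 0 r, D x ≠ 0 := fun x hx => one_add_conj_mul_ne_zero ha (hlt x hx)
  have hlin : ∀ x : ℝ, HasDerivAt (fun x : ℝ => e * (x : ℂ)) e x := fun x => by
    simpa using (Complex.ofRealCLM.hasDerivAt (x := x)).const_mul e
  have hφd : ∀ x ∈ Set.Icc 0 r, HasDerivAt φ (m / D x ^ 2) x := fun x hx => by
    have := (hasDerivAt_discAut ha (hlt x hx)).comp x (hlin x)
    refine this.congr_deriv ?_
    simp only [hm, hD]
    ring
  have hcomp := hsol.comp_discAut (c := e) ha he.le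
  have hball : ∀ x ∈ Set.Icc 0 r, (x : ℂ) ∈ Metric.ball (0 : ℂ) 1 := fun x hx => by
    simpa [abs_of_nonneg hx.1] using hx.2.trans_lt hr1
  have hzero : ∀ x ∈ Set.Ioo 0 r, D x * f (φ x) = 0 := by
    intro x hx
    refine eq_zero_of_norm_coeff_lt (B := fun x => A (φ x) * (m / D x ^ 2) ^ 2) hr1
      (fun x hx => (hcomp x (hball x hx)).1.comp_ofReal)
      (fun x hx => (hcomp x (hball x hx)).2.comp_ofReal) ?_ ?_ ?_ hx
    · intro x hx
      have hne := norm_ne_zero_iff.2 (hDne x hx)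
      have h1 : ‖φ x‖ < 1 := by simpa using hφball x hx
      have h2 := hcon (φ x) h1 (hφζ x hx)
      have h3 : 1 - ‖φ x‖ ^ 2 = (1 - ‖a‖ ^ 2) * (1 - x ^ 2) / ‖D x‖ ^ 2 := by
        rw [hφ, hD]
        simp only
        rw [one_sub_norm_sq_discAut ha (hlt x hx), hnorm x hx]
      rw [h3] at h2
      have h4 : 0 ≤ 1 - ‖a‖ ^ 2 := by nlinarith [norm_nonneg a]
      rw [norm_mul, norm_pow, norm_div, norm_pow, hm, norm_mul, he, Complex.norm_real,
        Real.norm_of_nonneg h4]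
      -- Conformal invariance: |A(φ)| |φ'|² (1 - x²)² = |A(φ)| (1 - |φ|²)².
      refine lt_of_eq_of_lt ?_ h2
      ring
    · simp [discAut, hfa]
    · rw [hφr, hfb, mul_zero]
  have hφ0 : φ 0 = a := by simp [hφ, discAut]
  -- Since φ'(0) ≠ 0, the geodesic leaves a at once, so the zeros along it accumulate at a and the
  -- identity theorem applies.
  have htend : Filter.Tendsto φ (nhdsWithin 0 (Set.Ioi 0)) (nhdsWithin a {a}ᶜ) := by
    have h0 : (0 : ℝ) ∈ Set.Icc 0 r := ⟨le_rfl, hr0.le⟩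
    refine tendsto_nhdsWithin_iff.2 ⟨?_, ?_⟩
    · rw [← hφ0]
      exact (hφd 0 h0).continuousAt.tendsto.mono_left nhdsWithin_le_nhds
    · have hne : m / D 0 ^ 2 ≠ 0 := by
        refine div_ne_zero (mul_ne_zero (norm_ne_zero_iff.1 (by rw [he]; exact one_ne_zero)) ?_)
          (pow_ne_zero _ (hDne 0 h0))
        have : (0 : ℝ) < 1 - ‖a‖ ^ 2 := by nlinarith [norm_nonneg a]
        exact_mod_cast this.ne'
      have h := (hφd 0 h0).eventually_ne hne (c := a)
      exact h.filter_mono (nhdsWithin_mono _ fun x hx => ne_of_gt hx)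
  have hfreq : ∃ᶠ z in nhdsWithin a {a}ᶜ, f z = 0 := by
    refine htend.frequently (Filter.Eventually.frequently ?_)
    filter_upwards [Ioo_mem_nhdsGT hr0] with x hx
    exact (mul_eq_zero.1 (hzero x hx)).resolve_left (hDne x (Set.Ioo_subset_Icc_self hx))
  have han : AnalyticOnNhd ℂ f (Metric.ball 0 1) := hfd.analyticOnNhd Metric.isOpen_ball
  exact hfz₀ (han.eqOn_zero_of_preconnected_of_frequently_eq_zero
    (convex_ball _ _).isPreconnected (by simpa using ha) hfreq hz₀)

/-- Pairs of zeros accumulating at `ζ` force the coefficient to be large near `ζ`. -/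
theorem HasZeroPairsNear.exists_boundaryLimit {A : ℂ → ℂ} {ζ : ℂ} (hζ : ‖ζ‖ = 1)
    (h : HasZeroPairsNear A ζ) :
    ∃ c ∈ Set.Icc (1 : EReal) ⊤, HasBoundaryLimitAlongSeq A ζ c := by
  have hex : ∀ n : ℕ, ∃ w : ℂ, ‖w‖ < 1 ∧ ‖w - ζ‖ ^ 2 < 2 * (1 / ((n : ℝ) + 1)) ^ 2 ∧
      1 ≤ ‖A w‖ * (1 - ‖w‖ ^ 2) ^ 2 := by
    intro n
    obtain ⟨f, hf, a, ⟨ha1, ha2⟩, b, ⟨hb1, hb2⟩, hab, hfa, hfb⟩ :=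
      h (1 / ((n : ℝ) + 1)) (by positivity)
    rw [mem_ball_iff_norm] at ha1 hb1
    exact hf.exists_one_le_norm_coeff hζ (by simpa using ha2) (by simpa using hb2) hab ha1 hb1
      hfa hfb
  choose w hw1 hwζ hwA using hex
  -- Compactness of the extended reals supplies a limit, possibly ∞.
  obtain ⟨c, ψ, hψ, hc⟩ := CompactSpace.tendsto_subseq
    (fun n => ((‖A (w n)‖ * (1 - ‖w n‖ ^ 2) ^ 2 : ℝ) : EReal))
  refine ⟨c, ⟨ge_of_tendsto' hc fun n => ?_, le_top⟩, w ∘ ψ, fun n => by simpa using hw1 (ψ n),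
    ?_, hc⟩
  · exact EReal.coe_le_coe_iff.2 (hwA (ψ n))
  · have hlim : Filter.Tendsto w Filter.atTop (nhds ζ) := by
      rw [tendsto_iff_norm_sub_tendsto_zero]
      have h1 : Filter.Tendsto (fun n : ℕ => Real.sqrt (2 * (1 / ((n : ℝ) + 1)) ^ 2))
          Filter.atTop (nhds 0) := by
        have := ((tendsto_one_div_add_atTop_nhds_zero_nat (𝕜 := ℝ)).pow 2).const_mul 2
        have h2 := (Real.continuous_sqrt.tendsto _).comp this
        rwa [show Real.sqrt (2 * 0 ^ 2) = 0 by simp] at h2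
      refine squeeze_zero (fun _ => norm_nonneg _) (fun n => ?_) h1
      exact Real.le_sqrt_of_sq_le (hwζ n).le
    exact hlim.comp hψ.tendsto_atTop

/-! ### The area theorem for b / u + H u -/

/-- A lower bound for the circular means of `‖(b / u + H u)'‖ ^ 2`. -/
theorem integral_norm_sq_neg_div_sq_add_deriv_ge {b : ℂ} {H : ℂ → ℂ}
    (hH : DifferentiableOn ℂ H (Metric.ball 0 1)) {t : ℝ} (ht0 : 0 < t) (ht1 : t < 1) :
    2 * Real.pi * (‖b‖ ^ 2 / t ^ 4 + ‖deriv H 0‖ ^ 2) ≤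
      ∫ θ in (-Real.pi)..Real.pi,
        ‖-b / circleMap 0 t θ ^ 2 + deriv H (circleMap 0 t θ)‖ ^ 2 := by
  set F : ℂ → ℝ := fun u => ‖-b / u ^ 2 + deriv H u‖ ^ 2 with hF
  set k : ℝ := ‖b‖ ^ 2 / t ^ 4 + ‖deriv H 0‖ ^ 2 with hk
  -- On |u| = t the conjugate of -b/u² equals -conj b u²/t⁴, so the cross term is the real part of a
  -- holomorphic function. With |y|² ≥ |z|² + 2 Re(conj z (y - z)) for z = H'(0), this gives Re Q ≤
  -- F on the circle, and the mean value property gives Q the average Q(0) = k.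
  set Q : ℂ → ℂ := fun u => k + (2 * (-conj b * u ^ 2 / t ^ 4 * deriv H u)
    + 2 * (conj (deriv H 0) * (deriv H u - deriv H 0))) with hQ
  have hd : DifferentiableOn ℂ (deriv H) (Metric.ball 0 1) := hH.deriv Metric.isOpen_ball
  have hQd : DifferentiableOn ℂ Q (Metric.ball 0 1) := by
    have : ∀ u, Q u = k + (2 * (-conj b * u ^ 2 * ((t : ℂ) ^ 4)⁻¹ * deriv H u)
      + 2 * (conj (deriv H 0) * (deriv H u - deriv H 0))) := fun u => by simp only [hQ]; ring
    rw [funext this]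
    fun_prop
  have hsub : Metric.closedBall (0 : ℂ) t ⊆ Metric.ball 0 1 := Metric.closedBall_subset_ball ht1
  have habs : |t| = t := abs_of_pos ht0
  have hsph : Metric.sphere (0 : ℂ) |t| ⊆ Metric.ball 0 1 := by
    rw [habs]; exact Metric.sphere_subset_closedBall.trans hsub
  have hQi : CircleIntegrable Q 0 t := (hQd.continuousOn.mono hsph).circleIntegrable'
  have hFi : CircleIntegrable F 0 t := by
    refine ContinuousOn.circleIntegrable' ?_
    have h1 : ContinuousOn (fun u : ℂ => -b / u ^ 2) (Metric.sphere 0 |t|) :=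
      continuousOn_const.div (by fun_prop) fun u hu => by
        have : ‖u‖ = t := by simpa [habs] using hu
        exact pow_ne_zero _ (norm_ne_zero_iff.1 (by rw [this]; exact ht0.ne'))
    exact ((h1.add (hd.continuousOn.mono hsph)).norm).pow 2
  have hQavg : Real.circleAverage (fun u => (Q u).re) 0 t = k := by
    have h1 := Complex.reCLM.circleAverage_comp_comm hQi
    have h2 : Real.circleAverage Q 0 t = Q 0 := by
      refine DiffContOnCl.circleAverage ?_
      rw [habs]
      exact (hQd.mono hsub).diffContOnCl_ball subset_rfl
    rw [h2] at h1
    have h3 : Q 0 = k := by simp [hQ]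
    rw [h3] at h1
    exact h1
  have hle : k ≤ Real.circleAverage F 0 t := by
    rw [← hQavg]
    refine Real.circleAverage_mono
      ((Complex.reCLM.continuous.comp_continuousOn
        (hQd.continuousOn.mono hsph)).circleIntegrable') hFi ?_
    intro u hu
    have hu' : ‖u‖ = t := by simpa [habs] using hu
    have hu0 : u ≠ 0 := norm_ne_zero_iff.1 (by rw [hu']; exact ht0.ne')
    have hcu : conj u ≠ 0 := (map_ne_zero _).2 hu0
    have hx : conj (-b / u ^ 2) = -conj b * u ^ 2 / t ^ 4 := by
      have h4 : (t : ℂ) ^ 4 = (u * conj u) ^ 2 := by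
        rw [Complex.mul_conj, Complex.normSq_eq_norm_sq, hu']; push_cast; ring
      rw [h4, map_div₀, map_neg, map_pow]
      field_simp
    have hxn : ‖-b / u ^ 2‖ ^ 2 = ‖b‖ ^ 2 / t ^ 4 := by
      rw [norm_div, norm_neg, norm_pow, hu', div_pow]; ring
    have key : ∀ x y z : ℂ, ‖x‖ ^ 2 + ‖z‖ ^ 2 + (2 * (conj x * y) + 2 * (conj z * (y - z))).re
        ≤ ‖x + y‖ ^ 2 := by
      intro x y z
      simp only [← Complex.normSq_eq_norm_sq, Complex.normSq_apply, Complex.add_re,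
        Complex.add_im, Complex.sub_re, Complex.sub_im, Complex.mul_re, Complex.mul_im,
        Complex.conj_re, Complex.conj_im, Complex.re_ofNat, Complex.im_ofNat]
      nlinarith [sq_nonneg (y.re - z.re), sq_nonneg (y.im - z.im)]
    have := key (-b / u ^ 2) (deriv H u) (deriv H 0)
    rw [hx, hxn] at this
    have e : (Q u).re = k + (2 * (-conj b * u ^ 2 / t ^ 4 * deriv H u)
        + 2 * (conj (deriv H 0) * (deriv H u - deriv H 0))).re := by
      simp only [hQ]
      rw [Complex.add_re, Complex.ofReal_re]
    rw [e]
    exact this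
  rw [Real.circleAverage_eq_integral_add (-Real.pi),
    intervalIntegral.integral_comp_add_right (fun θ => F (circleMap 0 t θ)), zero_add,
    show 2 * Real.pi + -Real.pi = Real.pi by ring, smul_eq_mul] at hle
  have hpi : 0 < 2 * Real.pi := by positivity
  rwa [inv_mul_eq_div, le_div_iff₀ hpi, mul_comm] at hle

/-- Integration in polar coordinates over an annulus. -/
theorem lintegral_annulus_ge {F : ℂ → ENNReal} (hF : Measurable F) {s r : ℝ} (hs : 0 < s) :
    ∫⁻ t in Set.Ioo s r, ENNReal.ofReal t * ∫⁻ θ in Set.Ioo (-Real.pi) Real.pi,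
      F (circleMap 0 t θ) ≤ ∫⁻ u in {u : ℂ | s < ‖u‖ ∧ ‖u‖ < r}, F u := by
  have hmeas : MeasurableSet {u : ℂ | s < ‖u‖ ∧ ‖u‖ < r} :=
    (measurableSet_lt measurable_const measurable_norm).inter
      (measurableSet_lt measurable_norm measurable_const)
  have hpm : Measurable fun p : ℝ × ℝ => circleMap 0 p.1 p.2 := by
    unfold circleMap; fun_prop
  rw [← lintegral_indicator hmeas, ← Complex.lintegral_comp_polarCoord_symm]
  have hsub : Set.Ioo s r ×ˢ Set.Ioo (-Real.pi) Real.pi ⊆ polarCoord.target := by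
    rw [polarCoord_target]
    exact Set.prod_mono (fun t ht => hs.trans ht.1) subset_rfl
  refine le_trans (le_of_eq ?_) (lintegral_mono_set hsub)
  have e : ∀ p ∈ Set.Ioo s r ×ˢ Set.Ioo (-Real.pi) Real.pi,
      ENNReal.ofReal p.1 • Set.indicator {u : ℂ | s < ‖u‖ ∧ ‖u‖ < r} F
        (Complex.polarCoord.symm p) = ENNReal.ofReal p.1 * F (circleMap 0 p.1 p.2) := by
    intro p hp
    have h1 : Complex.polarCoord.symm p = circleMap 0 p.1 p.2 := by
      rw [Complex.polarCoord_symm_apply, circleMap_zero, Complex.exp_mul_I]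
      push_cast; rfl
    have h2 : ‖circleMap 0 p.1 p.2‖ = p.1 := by
      rw [norm_circleMap_zero, abs_of_pos (hs.trans hp.1.1)]
    rw [h1, Set.indicator_of_mem, smul_eq_mul]
    simpa [h2] using hp.1
  rw [setLIntegral_congr_fun (measurableSet_Ioo.prod measurableSet_Ioo) e,
    Measure.volume_eq_prod, ← Measure.prod_restrict, lintegral_prod]
  · refine lintegral_congr fun t => ?_
    exact (lintegral_const_mul _ (hF.comp (hpm.comp measurable_prodMk_left))).symm
  · exact ((ENNReal.measurable_ofReal.comp measurable_fst).mul (hF.comp hpm)).aemeasurable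

theorem lintegral_annulus_norm_sq_ge {b : ℂ} {H : ℂ → ℂ}
    (hH : DifferentiableOn ℂ H (Metric.ball 0 1)) {s r : ℝ} (hs : 0 < s) (hsr : s ≤ r)
    (hr : r < 1) :
    ENNReal.ofReal (Real.pi * (‖b‖ ^ 2 * (1 / s ^ 2 - 1 / r ^ 2)
        + ‖deriv H 0‖ ^ 2 * (r ^ 2 - s ^ 2))) ≤
      ∫⁻ u in {u : ℂ | s < ‖u‖ ∧ ‖u‖ < r}, ENNReal.ofReal (‖-b / u ^ 2 + deriv H u‖ ^ 2) := by
  have hFm : Measurable fun u : ℂ => ENNReal.ofReal (‖-b / u ^ 2 + deriv H u‖ ^ 2) := by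
    have := measurable_deriv H
    fun_prop
  refine le_trans ?_ (lintegral_annulus_ge hFm hs)
  set p : ℝ → ℝ := fun t => t * (2 * Real.pi * (‖b‖ ^ 2 / t ^ 4 + ‖deriv H 0‖ ^ 2)) with hp
  have hd : DifferentiableOn ℂ (deriv H) (Metric.ball 0 1) := hH.deriv Metric.isOpen_ball
  have h1 : ∫⁻ t in Set.Ioo s r, ENNReal.ofReal (p t) ≤
      ∫⁻ t in Set.Ioo s r, ENNReal.ofReal t * ∫⁻ θ in Set.Ioo (-Real.pi) Real.pi,
        ENNReal.ofReal (‖-b / circleMap 0 t θ ^ 2 + deriv H (circleMap 0 t θ)‖ ^ 2) := by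
    refine setLIntegral_mono' measurableSet_Ioo fun t ht => ?_
    have ht0 : 0 < t := hs.trans ht.1
    have ht1 : t < 1 := ht.2.trans hr
    rw [hp, ENNReal.ofReal_mul ht0.le]
    gcongr
    have hcont : Continuous fun θ : ℝ =>
        ‖-b / circleMap 0 t θ ^ 2 + deriv H (circleMap 0 t θ)‖ ^ 2 := by
      have hc1 : Continuous fun θ : ℝ => deriv H (circleMap 0 t θ) :=
        hd.continuousOn.comp_continuous (continuous_circleMap 0 t) fun θ => by
          simpa [abs_of_pos ht0] using ht1
      have hc2 : Continuous fun θ : ℝ => -b / circleMap 0 t θ ^ 2 :=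
        continuous_const.div ((continuous_circleMap 0 t).pow 2) fun θ =>
          pow_ne_zero 2 (circleMap_ne_center ht0.ne')
      fun_prop
    have hint := (hcont.integrableOn_Icc (a := -Real.pi) (b := Real.pi)
      (μ := volume)).mono_set Set.Ioo_subset_Icc_self
    rw [← ofReal_integral_eq_lintegral_ofReal hint (ae_of_all _ fun θ => by positivity),
      ← integral_Ioc_eq_integral_Ioo,
      ← intervalIntegral.integral_of_le (by linarith [Real.pi_pos])]
    exact ENNReal.ofReal_le_ofReal (integral_norm_sq_neg_div_sq_add_deriv_ge hH ht0 ht1)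
  refine le_trans (le_of_eq ?_) h1
  have hpc : ContinuousOn p (Set.Icc s r) := by
    have : ContinuousOn (fun t : ℝ => ‖b‖ ^ 2 / t ^ 4) (Set.Icc s r) :=
      continuousOn_const.div (by fun_prop) fun t ht => pow_ne_zero 4 (hs.trans_le ht.1).ne'
    fun_prop
  have hpi : IntegrableOn p (Set.Ioo s r) :=
    hpc.integrableOn_Icc.mono_set Set.Ioo_subset_Icc_self
  have hpn : 0 ≤ᵐ[volume.restrict (Set.Ioo s r)] p := by
    filter_upwards [ae_restrict_mem measurableSet_Ioo] with t ht
    have : 0 < t := hs.trans ht.1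
    simp only [hp, Pi.zero_apply]
    positivity
  rw [← ofReal_integral_eq_lintegral_ofReal hpi hpn, ← integral_Ioc_eq_integral_Ioo,
    ← intervalIntegral.integral_of_le hsr]
  congr 1
  have hprim : ∀ t ∈ Set.uIcc s r, HasDerivAt
      (fun t : ℝ => Real.pi * (‖deriv H 0‖ ^ 2 * t ^ 2 - ‖b‖ ^ 2 * (t ^ 2)⁻¹)) (p t) t := by
    intro t ht
    rw [Set.uIcc_of_le hsr] at ht
    have ht0 : t ≠ 0 := (hs.trans_le ht.1).ne'
    have hsq : HasDerivAt (fun t : ℝ => t ^ 2) (2 * t) t := by simpa using hasDerivAt_pow 2 t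
    refine (((hsq.const_mul (‖deriv H 0‖ ^ 2)).sub
      ((hsq.inv (pow_ne_zero 2 ht0)).const_mul (‖b‖ ^ 2))).const_mul Real.pi).congr_deriv ?_
    simp only [hp]
    field_simp
    ring
  rw [intervalIntegral.integral_eq_sub_of_hasDerivAt hprim
    (by rw [← Set.uIcc_of_le hsr] at hpc; exact hpc.intervalIntegrable)]
  ring

/-- The Jacobian needed in the area formula for a holomorphic map. -/
theorem det_restrictScalars_toSpanSingleton (c : ℂ) :
    ((ContinuousLinearMap.toSpanSingleton ℂ c).restrictScalars ℝ).det = ‖c‖ ^ 2 := by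
  rw [ContinuousLinearMap.det, ContinuousLinearMap.coe_restrictScalars,
    LinearMap.det_restrictScalars, Algebra.norm_complex_apply, Complex.normSq_eq_norm_sq]
  simp [LinearMap.det_ring]

/-- The area of the image of an annulus under an injective map `b / u + H u`. -/
theorem volume_image_annulus_ge {b : ℂ} {H : ℂ → ℂ}
    (hH : DifferentiableOn ℂ H (Metric.ball 0 1))
    (hinj : Set.InjOn (fun u => b / u + H u) (Metric.ball 0 1 \ {0}))
    {s r : ℝ} (hs : 0 < s) (hsr : s ≤ r) (hr : r < 1) :
    ENNReal.ofReal (Real.pi * (‖b‖ ^ 2 * (1 / s ^ 2 - 1 / r ^ 2)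
        + ‖deriv H 0‖ ^ 2 * (r ^ 2 - s ^ 2))) ≤
      volume ((fun u => b / u + H u) '' {u : ℂ | s < ‖u‖ ∧ ‖u‖ < r}) := by
  have hmeas : MeasurableSet {u : ℂ | s < ‖u‖ ∧ ‖u‖ < r} :=
    (measurableSet_lt measurable_const measurable_norm).inter
      (measurableSet_lt measurable_norm measurable_const)
  have hsub : {u : ℂ | s < ‖u‖ ∧ ‖u‖ < r} ⊆ Metric.ball 0 1 \ {0} := by
    rintro u ⟨h1, h2⟩
    refine ⟨by simpa using h2.trans hr, ?_⟩
    rintro rfl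
    simp at h1
    linarith
  have hder : ∀ u ∈ {u : ℂ | s < ‖u‖ ∧ ‖u‖ < r},
      HasDerivAt (fun u => b / u + H u) (-b / u ^ 2 + deriv H u) u := by
    intro u hu
    have hu0 : u ≠ 0 := (hsub hu).2
    have h1 : HasDerivAt (fun u : ℂ => b / u) (-b / u ^ 2) u := by
      refine ((hasDerivAt_const u b).div (hasDerivAt_id u) hu0).congr_deriv ?_
      simp
    exact h1.add (hH.differentiableAt (Metric.isOpen_ball.mem_nhds (hsub hu).1)).hasDerivAt
  rw [← lintegral_abs_det_fderiv_eq_addHaar_image volume hmeas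
    (f' := fun u => (ContinuousLinearMap.toSpanSingleton ℂ
      (-b / u ^ 2 + deriv H u)).restrictScalars ℝ)
    (fun u hu => ((hder u hu).hasFDerivAt.restrictScalars ℝ).hasFDerivWithinAt)
    (hinj.mono hsub)]
  refine (lintegral_annulus_norm_sq_ge hH hs hsr hr).trans (le_of_eq ?_)
  refine lintegral_congr fun u => ?_
  rw [det_restrictScalars_toSpanSingleton, abs_of_nonneg (by positivity)]

/-- Let `b / u + H u` be injective. If it maps the circle of radius `s` into a closed convex set,
then it maps everything outside that circle into the same set. -/
theorem mem_of_forall_sphere_mem {b : ℂ} {H : ℂ → ℂ} (hb : b ≠ 0)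
    (hH : DifferentiableOn ℂ H (Metric.ball 0 1))
    (hinj : Set.InjOn (fun u => b / u + H u) (Metric.ball 0 1 \ {0}))
    {s : ℝ} (hs : 0 < s) {C : Set ℂ} (hC : Convex ℝ C) (hCc : IsClosed C)
    (hsC : ∀ u : ℂ, ‖u‖ = s → b / u + H u ∈ C) {v : ℂ} (hv : s < ‖v‖) (hv1 : ‖v‖ < 1) :
    b / v + H v ∈ C := by
  by_contra hmem
  obtain ⟨l, k, hl1, hl2⟩ := geometric_hahn_banach_point_closed hC hCc hmem
  set w := b / v + H v with hw
  set μ : ℂ := ⟨l 1, -l Complex.I⟩ with hμ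
  have hl : ∀ z : ℂ, l z = (μ * z).re := by
    intro z
    have : z = z.re • (1 : ℂ) + z.im • Complex.I := by
      apply Complex.ext <;> simp
    conv_lhs => rw [this]
    rw [map_add, map_smul, map_smul]
    simp [hμ]
    ring
  -- Here den u = u (b/u + H u - w). Injectivity keeps it from vanishing on |u| ≤ s, because the
  -- value w is already taken at v.
  set den : ℂ → ℂ := fun u => b + u * (H u - w) with hden
  have hden_ne : ∀ u : ℂ, ‖u‖ ≤ s → den u ≠ 0 := by
    intro u hu h
    rcases eq_or_ne u 0 with rfl | hu0
    · simp [hden] at h; exact hb h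
    · have h1 : b / u + H u = b / v + H v := by
        rw [← hw, ← sub_eq_zero]
        have : u * (b / u + H u - w) = den u := by simp only [hden]; field_simp; ring
        exact (mul_eq_zero.1 (this.trans h)).resolve_left hu0
      have h2 : u = v := hinj ⟨by simpa using hu.trans_lt (hv.trans hv1), hu0⟩
        ⟨by simpa using hv1, fun h0 => by
          rw [Set.mem_singleton_iff] at h0
          rw [h0, norm_zero] at hv; linarith⟩ h1
      rw [h2] at hu
      linarith
  have hpos : ∀ u : ℂ, ‖u‖ = s → 0 < (μ * (b / u + H u - w)).re := by
    intro u hu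
    rw [← hl, map_sub, sub_pos]
    exact hl1.trans (hl2 _ (hsC u hu))
  have hμ0 : μ ≠ 0 := by
    intro h0
    have := hpos s (by simp [abs_of_pos hs])
    simp [h0] at this
  -- The exponent is minus the reciprocal of μ (b/u + H u - w), extended by 0 across the pole.
  -- Separation makes |q| < 1 on |u| = s, while |q(0)| = 1, against the maximum principle.
  set q : ℂ → ℂ := fun u => Complex.exp (-(u / (μ * den u))) with hq
  have hqd : DifferentiableOn ℂ q (Metric.closedBall 0 s) := by
    have hHs : DifferentiableOn ℂ H (Metric.closedBall 0 s) :=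
      hH.mono (Metric.closedBall_subset_ball (hv.trans hv1))
    have hdd : DifferentiableOn ℂ (fun u => u / (μ * den u)) (Metric.closedBall 0 s) := by
      refine DifferentiableOn.div differentiableOn_id (by fun_prop) fun u hu => ?_
      exact mul_ne_zero hμ0 (hden_ne u (by simpa using hu))
    exact hdd.neg.cexp
  obtain ⟨u, hu, hmax⟩ := Complex.exists_mem_frontier_isMaxOn_norm (f := q)
    (Metric.isBounded_ball (x := (0 : ℂ)) (r := s)) ⟨0, Metric.mem_ball_self hs⟩
    (hqd.diffContOnCl_ball subset_rfl)
  rw [frontier_ball _ hs.ne'] at hu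
  have hus : ‖u‖ = s := by simpa using hu
  have hu0 : u ≠ 0 := norm_ne_zero_iff.1 (by rw [hus]; exact hs.ne')
  have h1 := hmax (subset_closure (Metric.mem_ball_self hs))
  simp only [Set.mem_ofPred_eq, Function.comp_apply, hq, Complex.norm_exp, zero_div, neg_zero,
    Complex.zero_re, Real.exp_le_exp, Complex.neg_re] at h1
  have h2 : u / (μ * den u) = (μ * (b / u + H u - w))⁻¹ := by
    have e : μ * (b / u + H u - w) = μ * den u / u := by
      simp only [hden]; field_simp; ring
    rw [e, inv_div]
  rw [h2, Complex.inv_re] at h1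
  have h3 := hpos u hus
  have h4 : 0 < Complex.normSq (μ * (b / u + H u - w)) :=
    Complex.normSq_pos.2 fun h => by rw [h] at h3; simp at h3
  have := div_pos h3 h4
  linarith

/-- The real-linear map `z ↦ z - κ * conj z`. -/
noncomputable def subConjMul (κ : ℂ) : ℂ →ₗ[ℝ] ℂ where
  toFun z := z - κ * conj z
  map_add' x y := by simp; ring
  map_smul' c x := by simp; ring

theorem subConjMul_apply (κ z : ℂ) : subConjMul κ z = z - κ * conj z := rfl

theorem det_subConjMul (κ : ℂ) : LinearMap.det (subConjMul κ) = 1 - ‖κ‖ ^ 2 := by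
  rw [← LinearMap.det_toMatrix Complex.basisOneI, Matrix.det_fin_two]
  simp only [LinearMap.toMatrix_apply, subConjMul_apply, Complex.coe_basisOneI_repr,
    ← Complex.normSq_eq_norm_sq, Complex.normSq_apply]
  simp
  ring

theorem norm_subConjMul_le {κ : ℂ} (hκ : ‖κ‖ ≤ 1) (z : ℂ) : ‖subConjMul κ z‖ ≤ 2 * ‖z‖ := by
  rw [subConjMul_apply]
  refine (norm_sub_le _ _).trans ?_
  rw [norm_mul, Complex.norm_conj]
  nlinarith [norm_nonneg z]

/-- The area of an ellipse. -/
theorem volume_preimage_subConjMul {κ : ℂ} (hκ : ‖κ‖ < 1) (c : ℂ) {R : ℝ} (hR : 0 ≤ R) :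
    volume ((fun z => -c + z) ⁻¹' (subConjMul κ ⁻¹' Metric.closedBall 0 R)) =
      ENNReal.ofReal (R ^ 2 / (1 - ‖κ‖ ^ 2) * Real.pi) := by
  have hpos : 0 < 1 - ‖κ‖ ^ 2 := by nlinarith [norm_nonneg κ]
  rw [measure_preimage_add, Measure.addHaar_preimage_linearMap _ (by
      rw [det_subConjMul]; exact hpos.ne'), det_subConjMul, Complex.volume_closedBall,
    abs_of_pos (inv_pos.2 hpos), ← ENNReal.ofReal_pow hR]
  have : (NNReal.pi : ENNReal) = ENNReal.ofReal Real.pi := by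
    rw [ENNReal.ofReal, ← NNReal.coe_real_pi, Real.toNNReal_coe]
  rw [this, ← ENNReal.ofReal_mul (by positivity), ← ENNReal.ofReal_mul (by positivity)]
  congr 1
  ring

/-- The image of the annulus lies in a slightly enlarged ellipse, and the areas are compared. An
ellipse is needed: the enclosing disc of radius |b|/s + |H'(0)| s would cost a term 2 |b| |H'(0)|
that survives s → 0. The singular terms |b|²/s² cancel. -/
theorem norm_sq_deriv_mul_le_of_forall_sphere {b : ℂ} {H : ℂ → ℂ} (hb : b ≠ 0)
    (hH : DifferentiableOn ℂ H (Metric.ball 0 1))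
    (hinj : Set.InjOn (fun u => b / u + H u) (Metric.ball 0 1 \ {0}))
    {s r η : ℝ} (hs : 0 < s) (hsr : s ≤ r) (hr : r < 1) (hη : 0 ≤ η)
    (hκ : ‖deriv H 0‖ * s ^ 2 ≤ ‖b‖ / 2)
    (herr : ∀ u : ℂ, ‖u‖ = s → ‖H u - H 0 - deriv H 0 * u‖ ≤ η * s) :
    ‖deriv H 0‖ ^ 2 * (r ^ 2 - s ^ 2) ≤ ‖b‖ ^ 2 / r ^ 2 + 4 * η * ‖b‖ + 8 * η ^ 2 * s ^ 2 := by
  have hbn : 0 < ‖b‖ := norm_pos_iff.2 hb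
  have hbc : conj b ≠ 0 := (map_ne_zero _).2 hb
  -- Chosen so that H'(0) u = κ conj (b/u) on |u| = s; then `subConjMul κ` maps the ellipse traced
  -- by b/u + H'(0) u onto a circle of radius d |b|/s.
  set κ : ℂ := deriv H 0 * (s : ℂ) ^ 2 / conj b with hκd
  have hκn : ‖κ‖ ≤ 1 / 2 := by
    rw [hκd, norm_div, norm_mul, norm_pow, Complex.norm_real, Complex.norm_conj,
      Real.norm_of_nonneg hs.le, div_le_iff₀ hbn]
    linarith
  have hk0 : 0 ≤ ‖κ‖ ^ 2 := sq_nonneg _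
  have hk1 : ‖κ‖ ^ 2 ≤ 1 / 2 := by nlinarith [norm_nonneg κ]
  set d : ℝ := 1 - ‖κ‖ ^ 2 with hd
  have hd0 : 1 / 2 ≤ d := by linarith
  have hd1 : d ≤ 1 := by linarith
  set R : ℝ := d * (‖b‖ / s) + 2 * (η * s) with hR
  have hR0 : 0 ≤ R := by positivity
  set C : Set ℂ := (fun z => -H 0 + z) ⁻¹' (subConjMul κ ⁻¹' Metric.closedBall 0 R) with hC
  have hCconv : Convex ℝ C :=
    ((convex_closedBall (0 : ℂ) R).linear_preimage (subConjMul κ)).translate_preimage_right _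
  have hCcl : IsClosed C :=
    (Metric.isClosed_closedBall.preimage
      (subConjMul κ).continuous_of_finiteDimensional).preimage (by fun_prop)
  have hsC : ∀ u : ℂ, ‖u‖ = s → b / u + H u ∈ C := by
    intro u hu
    have hu0 : u ≠ 0 := norm_ne_zero_iff.1 (by rw [hu]; exact hs.ne')
    have hcu : conj u ≠ 0 := (map_ne_zero _).2 hu0
    have hmain : subConjMul κ (b / u + deriv H 0 * u) = (d : ℂ) * (b / u) := by
      have h1 : (s : ℂ) ^ 2 = u * conj u := by
        rw [Complex.mul_conj, Complex.normSq_eq_norm_sq, hu]; push_cast; rfl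
      have h2 : (d : ℂ) = 1 - κ * conj κ := by
        rw [Complex.mul_conj, Complex.normSq_eq_norm_sq, hd]; push_cast; rfl
      rw [h2, subConjMul_apply, hκd, h1]
      simp only [map_add, map_div₀, map_mul, Complex.conj_conj]
      field_simp
      ring
    have hsplit : -H 0 + (b / u + H u)
        = (b / u + deriv H 0 * u) + (H u - H 0 - deriv H 0 * u) := by ring
    rw [hC, Set.mem_preimage, Set.mem_preimage, mem_closedBall_zero_iff, hsplit, map_add, hmain]
    refine (norm_add_le _ _).trans (add_le_add (le_of_eq ?_) ?_)
    · rw [norm_mul, Complex.norm_real, norm_div, hu, Real.norm_of_nonneg (by linarith)]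
    · refine (norm_subConjMul_le (hκn.trans (by norm_num)) _).trans ?_
      have := herr u hu
      linarith
  have himg : (fun u => b / u + H u) '' {u : ℂ | s < ‖u‖ ∧ ‖u‖ < r} ⊆ C := by
    rintro _ ⟨v, ⟨hv1, hv2⟩, rfl⟩
    exact mem_of_forall_sphere_mem hb hH hinj hs hCconv hCcl hsC hv1 (hv2.trans hr)
  have hvol := (volume_image_annulus_ge hH hinj hs hsr hr).trans (measure_mono himg)
  rw [hC, volume_preimage_subConjMul (hκn.trans_lt (by norm_num)) _ hR0, ← hd,
    ENNReal.ofReal_le_ofReal_iff (by positivity), mul_comm (R ^ 2 / d)] at hvol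
  have hle := le_of_mul_le_mul_left hvol Real.pi_pos
  have hRd : R ^ 2 / d ≤ ‖b‖ ^ 2 / s ^ 2 + 4 * η * ‖b‖ + 8 * η ^ 2 * s ^ 2 := by
    have e : R ^ 2 / d = d * (‖b‖ ^ 2 / s ^ 2) + 4 * η * ‖b‖ + 4 * η ^ 2 * s ^ 2 / d := by
      have : d ≠ 0 := by linarith
      rw [hR]; field_simp; ring
    have h1 : d * (‖b‖ ^ 2 / s ^ 2) ≤ ‖b‖ ^ 2 / s ^ 2 := mul_le_of_le_one_left (by positivity) hd1
    have h2 : 4 * η ^ 2 * s ^ 2 / d ≤ 8 * η ^ 2 * s ^ 2 := by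
      rw [div_le_iff₀ (by linarith)]
      nlinarith [mul_nonneg (mul_nonneg (by norm_num : (0 : ℝ) ≤ 8) (sq_nonneg η)) (sq_nonneg s)]
    rw [e]
    linarith
  have e1 : ‖b‖ ^ 2 * (1 / s ^ 2 - 1 / r ^ 2) = ‖b‖ ^ 2 / s ^ 2 - ‖b‖ ^ 2 / r ^ 2 := by ring
  linarith

/-- **Area theorem**, first coefficient: if `b / u + H u` is injective on the punctured unit
disc, then `‖H' 0‖ ≤ ‖b‖`. -/
theorem norm_deriv_le_of_injOn {b : ℂ} {H : ℂ → ℂ} (hb : b ≠ 0)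
    (hH : DifferentiableOn ℂ H (Metric.ball 0 1))
    (hinj : Set.InjOn (fun u => b / u + H u) (Metric.ball 0 1 \ {0})) :
    ‖deriv H 0‖ ≤ ‖b‖ := by
  have hbn : 0 < ‖b‖ := norm_pos_iff.2 hb
  have hdiff : HasDerivAt H (deriv H 0) 0 :=
    (hH.differentiableAt (Metric.isOpen_ball.mem_nhds (by simp))).hasDerivAt
  -- The limits are taken in the order s → 0, η → 0, r → 1; the `0 ^ 2` is the limit of s².
  have step : ∀ r : ℝ, 0 < r → r < 1 → ∀ η : ℝ, 0 < η →
      ‖deriv H 0‖ ^ 2 * (r ^ 2 - 0 ^ 2) ≤ ‖b‖ ^ 2 / r ^ 2 + 4 * η * ‖b‖ + 8 * η ^ 2 * 0 ^ 2 := by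
    intro r hr0 hr1 η hη
    have herr : ∀ᶠ s : ℝ in nhdsWithin 0 (Set.Ioi 0), ∀ u : ℂ, ‖u‖ = s →
        ‖H u - H 0 - deriv H 0 * u‖ ≤ η * s := by
      have h1 := hdiff.isLittleO.def hη
      obtain ⟨ε, hε, h2⟩ := Metric.eventually_nhds_iff.1 h1
      filter_upwards [Ioo_mem_nhdsGT hε] with s hs u hu
      have := h2 (y := u) (by rw [dist_zero_right, hu]; exact hs.2)
      simpa [hu, mul_comm] using this
    have hκ : ∀ᶠ s : ℝ in nhdsWithin 0 (Set.Ioi 0), ‖deriv H 0‖ * s ^ 2 ≤ ‖b‖ / 2 := by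
      have h1 : Filter.Tendsto (fun s : ℝ => ‖deriv H 0‖ * s ^ 2) (nhds 0)
          (nhds (‖deriv H 0‖ * 0 ^ 2)) := Continuous.tendsto (by fun_prop) 0
      have h2 : ‖deriv H 0‖ * 0 ^ 2 < ‖b‖ / 2 := by simpa using hbn
      exact ((h1.eventually_lt_const h2).filter_mono nhdsWithin_le_nhds).mono fun s hs => hs.le
    have hl : Filter.Tendsto (fun s : ℝ => ‖deriv H 0‖ ^ 2 * (r ^ 2 - s ^ 2))
        (nhdsWithin 0 (Set.Ioi 0)) (nhds (‖deriv H 0‖ ^ 2 * (r ^ 2 - 0 ^ 2))) :=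
      (Continuous.tendsto (by fun_prop) 0).mono_left nhdsWithin_le_nhds
    have hu : Filter.Tendsto (fun s : ℝ => ‖b‖ ^ 2 / r ^ 2 + 4 * η * ‖b‖ + 8 * η ^ 2 * s ^ 2)
        (nhdsWithin 0 (Set.Ioi 0))
        (nhds (‖b‖ ^ 2 / r ^ 2 + 4 * η * ‖b‖ + 8 * η ^ 2 * 0 ^ 2)) :=
      (Continuous.tendsto (by fun_prop) 0).mono_left nhdsWithin_le_nhds
    refine le_of_tendsto_of_tendsto hl hu ?_
    filter_upwards [herr, hκ, Ioo_mem_nhdsGT hr0] with s h1 h2 h3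
    exact norm_sq_deriv_mul_le_of_forall_sphere hb hH hinj h3.1 h3.2.le hr1 hη.le h2 h1
  have step2 : ∀ r : ℝ, 0 < r → r < 1 → ‖deriv H 0‖ * r ^ 2 ≤ ‖b‖ := by
    intro r hr0 hr1
    have h1 : ‖deriv H 0‖ ^ 2 * r ^ 2 ≤ ‖b‖ ^ 2 / r ^ 2 := by
      refine le_of_forall_pos_le_add fun ε hε => ?_
      have h := step r hr0 hr1 (ε / (4 * ‖b‖)) (by positivity)
      have e : 4 * (ε / (4 * ‖b‖)) * ‖b‖ = ε := by field_simp
      rw [e] at h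
      simpa using h
    rw [le_div_iff₀ (by positivity)] at h1
    refine le_of_sq_le_sq ?_ hbn.le
    linarith
  have hl : Filter.Tendsto (fun r : ℝ => ‖deriv H 0‖ * r ^ 2) (nhdsWithin 1 (Set.Iio 1))
      (nhds (‖deriv H 0‖ * 1 ^ 2)) :=
    (Continuous.tendsto (by fun_prop) 1).mono_left nhdsWithin_le_nhds
  have h := le_of_tendsto hl (b := ‖b‖) (by
    filter_upwards [Ioo_mem_nhdsLT (zero_lt_one (α := ℝ))] with r hr using step2 r hr.1 hr.2)
  simpa using h

/-! ### Kraus' theorem -/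

/-- Here p = u - B(0) u³/6 + ... and q = 1 - B(0) u²/2 + ..., so q/p = 1/u + H(u) with H'(0) =
-B(0)/3, and the area theorem applies. The coefficient is found by differentiating u q = p + u p H
three times at 0. -/
theorem SolvesWithDeriv.norm_coeff_le_three_of_normalized {B p p' q q' : ℂ → ℂ}
    (hB : DifferentiableOn ℂ B (Metric.ball 0 1))
    (hp : SolvesWithDeriv B p p') (hq : SolvesWithDeriv B q q')
    (hp0 : p 0 = 0) (hp'0 : p' 0 = 1) (hq0 : q 0 = 1) (hq'0 : q' 0 = 0)
    (hinj : ∀ u ∈ Metric.ball (0 : ℂ) 1, ∀ v ∈ Metric.ball (0 : ℂ) 1, u ≠ v →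
      p u * q v - p v * q u ≠ 0) :
    ‖B 0‖ ≤ 3 := by
  have h0 : (0 : ℂ) ∈ Metric.ball (0 : ℂ) 1 := by simp
  have hpne : ∀ u ∈ Metric.ball (0 : ℂ) 1, u ≠ 0 → p u ≠ 0 := fun u hu hu0 => by
    simpa [hp0, hq0] using hinj u hu 0 h0 hu0
  set h := dslope p 0 with hh
  have hhd : DifferentiableOn ℂ h (Metric.ball 0 1) :=
    (Complex.differentiableOn_dslope (Metric.isOpen_ball.mem_nhds h0)).2 hp.differentiableOn
  have hph : ∀ u, p u = u * h u := fun u => by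
    have := sub_smul_dslope p 0 u
    simpa [hp0] using this.symm
  have hh0 : h 0 = 1 := by rw [hh, dslope_same, (hp 0 h0).1.deriv, hp'0]
  have hhne : ∀ u ∈ Metric.ball (0 : ℂ) 1, h u ≠ 0 := fun u hu h0 => by
    rcases eq_or_ne u 0 with rfl | hu0
    · rw [hh0] at h0; exact one_ne_zero h0
    · exact hpne u hu hu0 (by rw [hph, h0, mul_zero])
  set N : ℂ → ℂ := fun u => q u / h u with hN
  have hNd : DifferentiableOn ℂ N (Metric.ball 0 1) := hq.differentiableOn.div hhd hhne
  set H := dslope N 0 with hH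
  have hHd : DifferentiableOn ℂ H (Metric.ball 0 1) :=
    (Complex.differentiableOn_dslope (Metric.isOpen_ball.mem_nhds h0)).2 hNd
  have hNH : ∀ u, N u = 1 + u * H u := fun u => by
    have := sub_smul_dslope N 0 u
    have e : N 0 = 1 := by simp [hN, hq0, hh0]
    rw [e, sub_zero, smul_eq_mul] at this
    rw [hH, this]; ring
  have hrel : ∀ u ∈ Metric.ball (0 : ℂ) 1, u * q u = p u + u * (p u * H u) := fun u hu => by
    have e : q u = h u * (1 + u * H u) := by
      rw [← hNH, hN]; exact (mul_div_cancel₀ _ (hhne u hu)).symm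
    rw [hph u, e]; ring
  have hquot : ∀ u ∈ Metric.ball (0 : ℂ) 1, u ≠ 0 → q u / p u = 1 / u + H u := fun u hu hu0 => by
    rw [div_eq_iff (hpne u hu hu0)]
    field_simp
    linear_combination hrel u hu
  have harea : ‖deriv H 0‖ ≤ ‖(1 : ℂ)‖ := by
    refine norm_deriv_le_of_injOn one_ne_zero hHd ?_
    rintro u ⟨hu, hu0⟩ v ⟨hv, hv0⟩ huv
    by_contra hne
    refine hinj u hu v hv hne ?_
    simp only at huv
    rw [← hquot u hu hu0, ← hquot v hv hv0, div_eq_div_iff (hpne u hu hu0) (hpne v hv hv0)] at huv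
    linear_combination -huv
  have hHder : ∀ u ∈ Metric.ball (0 : ℂ) 1, HasDerivAt H (deriv H u) u := fun u hu =>
    (hHd.differentiableAt (Metric.isOpen_ball.mem_nhds hu)).hasDerivAt
  have hH2 : DifferentiableOn ℂ (deriv H) (Metric.ball 0 1) := hHd.deriv Metric.isOpen_ball
  have hHder2 : ∀ u ∈ Metric.ball (0 : ℂ) 1, HasDerivAt (deriv H) (deriv (deriv H) u) u :=
    fun u hu => (hH2.differentiableAt (Metric.isOpen_ball.mem_nhds hu)).hasDerivAt
  have hHder3 : HasDerivAt (deriv (deriv H)) (deriv (deriv (deriv H)) 0) 0 :=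
    ((hH2.deriv Metric.isOpen_ball).differentiableAt (Metric.isOpen_ball.mem_nhds h0)).hasDerivAt
  have hBder : HasDerivAt B (deriv B 0) 0 :=
    (hB.differentiableAt (Metric.isOpen_ball.mem_nhds h0)).hasDerivAt
  have huniq : ∀ {F G : ℂ → ℂ} {F' G' u : ℂ}, u ∈ Metric.ball (0 : ℂ) 1 →
      (∀ z ∈ Metric.ball (0 : ℂ) 1, F z = G z) → HasDerivAt F F' u → HasDerivAt G G' u →
      F' = G' := by
    intro F G F' G' u hu hFG hF hG
    refine hF.unique (hG.congr_of_eventuallyEq ?_)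
    filter_upwards [Metric.isOpen_ball.mem_nhds hu] with z hz using hFG z hz
  have hrel1 : ∀ u ∈ Metric.ball (0 : ℂ) 1, 1 * q u + u * q' u = p' u + (1 * (p u * H u)
      + u * (p' u * H u + p u * deriv H u)) := fun u hu =>
    huniq hu hrel ((hasDerivAt_id u).mul (hq u hu).1)
      ((hp u hu).1.add ((hasDerivAt_id u).mul ((hp u hu).1.mul (hHder u hu))))
  have hrel2 : ∀ u ∈ Metric.ball (0 : ℂ) 1, 2 * q' u + u * (-(B u * q u))
      = -(B u * p u) + (2 * (p' u * H u + p u * deriv H u)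
        + u * (-(B u * p u) * H u + 2 * (p' u * deriv H u) + p u * deriv (deriv H) u)) := by
    intro u hu
    have hpH := (hp u hu).1.mul (hHder u hu)
    have hpH' := ((hp u hu).2.mul (hHder u hu)).add ((hp u hu).1.mul (hHder2 u hu))
    have := huniq hu hrel1
      (((hq u hu).1.const_mul 1).add ((hasDerivAt_id u).mul (hq u hu).2))
      ((hp u hu).2.add ((hpH.const_mul 1).add ((hasDerivAt_id u).mul hpH')))
    simp only [id] at this
    linear_combination this
  have hrel3 : -(3 * B 0) = -B 0 + 6 * deriv H 0 := by
    have hpH := (hp 0 h0).1.mul (hHder 0 h0)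
    have hpH' := ((hp 0 h0).2.mul (hHder 0 h0)).add ((hp 0 h0).1.mul (hHder2 0 h0))
    have hBp := (hBder.mul (hp 0 h0).1).neg
    have := huniq h0 hrel2
      (((hq 0 h0).2.const_mul 2).add ((hasDerivAt_id (0 : ℂ)).mul (hBder.mul (hq 0 h0).1).neg))
      (hBp.add ((hpH'.const_mul 2).add ((hasDerivAt_id (0 : ℂ)).mul
        (((hBp.mul (hHder 0 h0)).add (((hp 0 h0).2.mul (hHder2 0 h0)).const_mul 2)).add
          ((hp 0 h0).1.mul hHder3)))))
    simp [hp0, hp'0, hq0, hq'0] at this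
    linear_combination this
  have hB0 : B 0 = -3 * deriv H 0 := by linear_combination (-1 / 2 : ℂ) * hrel3
  rw [hB0, norm_mul, norm_neg, Complex.norm_ofNat]
  rw [norm_one] at harea
  linarith

/-- **Kraus' theorem** at the centre of the disc: if the quotient of two linearly independent
solutions of `f'' + B f = 0` is injective in the unit disc, then `‖B 0‖ ≤ 3`. -/
theorem SolvesWithDeriv.norm_coeff_le_three {B f f' g g' : ℂ → ℂ}
    (hB : DifferentiableOn ℂ B (Metric.ball 0 1))
    (hf : SolvesWithDeriv B f f') (hg : SolvesWithDeriv B g g')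
    (hW : f' 0 * g 0 - f 0 * g' 0 ≠ 0)
    (hinj : ∀ u ∈ Metric.ball (0 : ℂ) 1, ∀ v ∈ Metric.ball (0 : ℂ) 1, u ≠ v →
      f u * g v - f v * g u ≠ 0) :
    ‖B 0‖ ≤ 3 := by
  set ω := f' 0 * g 0 - f 0 * g' 0 with hω
  -- The combinations with initial data (0, 1) and (1, 0), obtained by inverting the matrix of
  -- initial data.
  refine norm_coeff_le_three_of_normalized hB (hf.linearCombination hg (g 0 / ω) (-f 0 / ω))
    (hf.linearCombination hg (-g' 0 / ω) (f' 0 / ω)) ?_ ?_ ?_ ?_ ?_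
  · ring
  · field_simp; rw [hω]; ring
  · field_simp; rw [hω]; ring
  · ring
  · intro u hu v hv huv
    have e : (g 0 / ω * f u + -f 0 / ω * g u) * (-g' 0 / ω * f v + f' 0 / ω * g v)
        - (g 0 / ω * f v + -f 0 / ω * g v) * (-g' 0 / ω * f u + f' 0 / ω * g u)
        = (f u * g v - f v * g u) / ω := by
      field_simp
      rw [hω]; ring
    rw [e]
    exact div_ne_zero (hinj u hu v hv huv) hW

/-! ### A large coefficient forces zeros -/

theorem injOn_discAut {a : ℂ} (ha : ‖a‖ < 1) : Set.InjOn (discAut a) (Metric.ball 0 1) := by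
  intro u hu v hv h
  have hu' : ‖u‖ < 1 := by simpa using hu
  have hv' : ‖v‖ < 1 := by simpa using hv
  rw [discAut, discAut, div_eq_div_iff (one_add_conj_mul_ne_zero ha hu')
    (one_add_conj_mul_ne_zero ha hv')] at h
  have h1 : (1 - a * conj a) * (u - v) = 0 := by linear_combination h
  have h2 : 1 - a * conj a ≠ 0 := by
    have : (0 : ℝ) < 1 - ‖a‖ ^ 2 := by nlinarith [norm_nonneg a]
    rw [Complex.mul_conj, Complex.normSq_eq_norm_sq]
    exact_mod_cast this.ne'
  exact sub_eq_zero.1 ((mul_eq_zero.1 h1).resolve_left h2)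

/-- A hyperbolic disc of fixed radius shrinks to a point in the Euclidean sense as its centre tends
to the boundary, so it eventually fits inside D(ζ, δ). -/
theorem norm_discAut_sub_le {a u : ℂ} {r : ℝ} (ha : ‖a‖ < 1) (hr : r < 1) (hu : ‖u‖ ≤ r) :
    ‖discAut a u - a‖ ≤ (1 - ‖a‖ ^ 2) / (1 - r) := by
  have hne := one_add_conj_mul_ne_zero ha (hu.trans_lt hr)
  have h1 : 0 < 1 - ‖a‖ ^ 2 := by nlinarith [norm_nonneg a]
  have e : discAut a u - a = ((1 - ‖a‖ ^ 2 : ℝ) : ℂ) * u / (1 + conj a * u) := by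
    have : ((1 - ‖a‖ ^ 2 : ℝ) : ℂ) = 1 - a * conj a := by
      rw [Complex.mul_conj, Complex.normSq_eq_norm_sq]; push_cast; ring
    rw [this, discAut, div_sub' hne]
    congr 1
    ring
  have hden : 1 - r ≤ ‖1 + conj a * u‖ := by
    have h2 := norm_sub_norm_le (1 : ℂ) (-(conj a * u))
    rw [sub_neg_eq_add, norm_neg, norm_mul, norm_one, Complex.norm_conj] at h2
    nlinarith [norm_nonneg a, norm_nonneg u]
  rw [e, norm_div, norm_mul, Complex.norm_real, Real.norm_of_nonneg h1.le]
  have hr1 : 0 < 1 - r := by linarith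
  gcongr
  nlinarith [norm_nonneg u]

/-- If no non-trivial solution has two distinct zeros in `D(ζ, δ) ∩ 𝔻`, then the coefficient
is controlled at all points that are well inside `D(ζ, δ)`. -/
theorem sq_mul_norm_coeff_le_three {A : ℂ → ℂ} (hA : DifferentiableOn ℂ A (Metric.ball 0 1))
    {ζ w : ℂ} {δ r : ℝ}
    (hzeros : ∀ f, IsNontrivialSolution A f → ∀ z₁ ∈ Metric.ball ζ δ ∩ Metric.ball 0 1,
      ∀ z₂ ∈ Metric.ball ζ δ ∩ Metric.ball 0 1, z₁ ≠ z₂ → f z₁ = 0 → f z₂ ≠ 0)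
    (hw : ‖w‖ < 1) (hr0 : 0 < r) (hr1 : r < 1)
    (hdist : (1 - ‖w‖ ^ 2) / (1 - r) + ‖w - ζ‖ < δ) :
    r ^ 2 * (‖A w‖ * (1 - ‖w‖ ^ 2) ^ 2) ≤ 3 := by
  obtain ⟨f, f', hf0, hf'0, hf⟩ := exists_solution hA 0 1
  obtain ⟨g, g', hg0, hg'0, hg⟩ := exists_solution hA 1 0
  have hW : ∀ z ∈ Metric.ball (0 : ℂ) 1, f' z * g z - f z * g' z = 1 := fun z hz => by
    rw [hf.wronskian_eq hg hz, hf0, hf'0, hg0, hg'0]; ring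
  have hpair : ∀ z₁ ∈ Metric.ball ζ δ ∩ Metric.ball 0 1,
      ∀ z₂ ∈ Metric.ball ζ δ ∩ Metric.ball 0 1, z₁ ≠ z₂ → f z₁ * g z₂ - f z₂ * g z₁ ≠ 0 := by
    intro z₁ hz₁ z₂ hz₂ hne heq
    -- This combination vanishes at z₁, and at z₂ when the determinant is 0. Its derivative at z₁ is
    -- minus the Wronskian, so it is non-trivial.
    have hk := hf.linearCombination hg (-g z₁) (f z₁)
    refine hzeros _ ⟨hk.differentiableOn, fun z hz => hk.deriv_deriv_add hz, ?_⟩ z₁ hz₁ z₂ hz₂ hne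
      (by ring) (by linear_combination heq)
    by_contra! hall
    have hd0 : -g z₁ * f' z₁ + f z₁ * g' z₁ = 0 := by
      refine (hk z₁ hz₁.2).1.unique ((hasDerivAt_const z₁ (0 : ℂ)).congr_of_eventuallyEq ?_)
      filter_upwards [Metric.isOpen_ball.mem_nhds hz₁.2] with z hz using hall z hz
    have := hW z₁ hz₁.2
    exact one_ne_zero (α := ℂ) (by linear_combination -this - hd0)
  have hrn : ‖(r : ℂ)‖ = r := by rw [Complex.norm_real, Real.norm_of_nonneg hr0.le]
  have hrc : (r : ℂ) ≠ 0 := by exact_mod_cast hr0.ne'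
  have hnorm : ∀ u ∈ Metric.ball (0 : ℂ) 1, ‖(r : ℂ) * u‖ ≤ r := fun u hu => by
    have : ‖u‖ < 1 := by simpa using hu
    rw [norm_mul, hrn]
    nlinarith [norm_nonneg u]
  have hmem : ∀ u ∈ Metric.ball (0 : ℂ) 1,
      discAut w (r * u) ∈ Metric.ball ζ δ ∩ Metric.ball 0 1 := fun u hu => by
    refine ⟨?_, by simpa using norm_discAut_lt_one hw ((hnorm u hu).trans_lt hr1)⟩
    rw [mem_ball_iff_norm, ← sub_add_sub_cancel _ w]
    exact ((norm_add_le _ _).trans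
      (add_le_add_left (norm_discAut_sub_le hw hr1 (hnorm u hu)) _)).trans_lt hdist
  have hm : 0 < 1 - ‖w‖ ^ 2 := by nlinarith [norm_nonneg w]
  have hmc : ((1 - ‖w‖ ^ 2 : ℝ) : ℂ) ≠ 0 := by exact_mod_cast hm.ne'
  have hden : ∀ u ∈ Metric.ball (0 : ℂ) 1, 1 + conj w * (r * u) ≠ 0 := fun u hu =>
    one_add_conj_mul_ne_zero hw ((hnorm u hu).trans_lt hr1)
  -- Kraus' theorem is applied to the pullback under u ↦ `discAut w (r * u)`, whose derivative at 0
  -- is r (1 - |w|²).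
  have hkey := (hf.comp_discAut hw (hrn.trans_le hr1.le)).norm_coeff_le_three ?_
    (hg.comp_discAut hw (hrn.trans_le hr1.le)) ?_ ?_
  · simp only [discAut, mul_zero, add_zero, div_one, one_pow, norm_mul, norm_pow, hrn,
      Complex.norm_real, Real.norm_of_nonneg hm.le] at hkey
    linarith
  · have hφ : DifferentiableOn ℂ (fun u : ℂ => discAut w (r * u)) (Metric.ball 0 1) := by
      intro u hu
      exact ((hasDerivAt_discAut hw ((hnorm u hu).trans_lt hr1)).differentiableAt.comp u
        (by fun_prop)).differentiableWithinAt
    refine (hA.comp hφ fun u hu => (hmem u hu).2).mul (DifferentiableOn.pow ?_ 2)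
    exact (differentiableOn_const _).div (by fun_prop) fun u hu => pow_ne_zero 2 (hden u hu)
  · simp only [discAut, mul_zero, add_zero, div_one, one_mul]
    have := hW w (by simpa using hw)
    have e : (conj w * r * f w + r * ((1 - ‖w‖ ^ 2 : ℝ) : ℂ) * f' w) * g w
        - f w * (conj w * r * g w + r * ((1 - ‖w‖ ^ 2 : ℝ) : ℂ) * g' w)
        = r * ((1 - ‖w‖ ^ 2 : ℝ) : ℂ) := by
      linear_combination r * ((1 - ‖w‖ ^ 2 : ℝ) : ℂ) * this
    rw [e]
    exact mul_ne_zero hrc hmc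
  · intro u hu v hv huv
    have hne : discAut w (r * u) ≠ discAut w (r * v) := fun h => by
      refine huv (mul_left_cancel₀ hrc (injOn_discAut hw ?_ ?_ h))
      · simpa using (hnorm u hu).trans_lt hr1
      · simpa using (hnorm v hv).trans_lt hr1
    have hp := mul_ne_zero (mul_ne_zero (hden u hu) (hden v hv))
      (hpair _ (hmem u hu) _ (hmem v hv) hne)
    intro h
    exact hp (by linear_combination h)

/-- A coefficient exceeding `3` near `ζ` produces pairs of zeros near `ζ`. -/
theorem HasBoundaryLimitAlongSeq.hasZeroPairsNear {A : ℂ → ℂ}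
    (hA : DifferentiableOn ℂ A (Metric.ball 0 1)) {ζ : ℂ} (hζ : ‖ζ‖ = 1) {c : EReal}
    (hc : 3 < c) (h : HasBoundaryLimitAlongSeq A ζ c) : HasZeroPairsNear A ζ := by
  obtain ⟨w, hw, hwζ, hwc⟩ := h
  obtain ⟨k, hk3, hkc⟩ := EReal.lt_iff_exists_real_btwn.1 hc
  have hk : (3 : ℝ) < k := EReal.coe_lt_coe_iff.1 hk3
  have hlarge : ∀ᶠ n in Filter.atTop, k < ‖A (w n)‖ * (1 - ‖w n‖ ^ 2) ^ 2 :=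
    (hwc.eventually_const_lt hkc).mono fun n hn => EReal.coe_lt_coe_iff.1 hn
  -- Taking r² = (3 + k)/(2k) makes r² k the midpoint of 3 and k.
  obtain ⟨r, hr0, hr1, hrk⟩ : ∃ r : ℝ, 0 < r ∧ r < 1 ∧ 3 < r ^ 2 * k := by
    have h1 : (3 + k) / (2 * k) < 1 := by rw [div_lt_one (by linarith)]; linarith
    have h0 : 0 < (3 + k) / (2 * k) := by positivity
    refine ⟨Real.sqrt ((3 + k) / (2 * k)), Real.sqrt_pos.2 h0, ?_, ?_⟩
    · rw [Real.sqrt_lt' one_pos]; simpa using h1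
    · rw [Real.sq_sqrt h0.le]
      have : (3 + k) / (2 * k) * k = (3 + k) / 2 := by field_simp
      rw [this]; linarith
  intro δ hδ
  have hdist : Filter.Tendsto (fun n => (1 - ‖w n‖ ^ 2) / (1 - r) + ‖w n - ζ‖) Filter.atTop
      (nhds ((1 - ‖ζ‖ ^ 2) / (1 - r) + ‖ζ - ζ‖)) :=
    ((tendsto_const_nhds.sub (hwζ.norm.pow 2)).div_const _).add (hwζ.sub_const ζ).norm
  have hzero : (1 - ‖ζ‖ ^ 2) / (1 - r) + ‖ζ - ζ‖ < δ := by simpa [hζ] using hδ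
  obtain ⟨n, hn1, hn2⟩ := (hlarge.and (hdist.eventually_lt_const hzero)).exists
  by_contra! hcon
  have hle := sq_mul_norm_coeff_le_three hA hcon (by simpa using hw n) hr0 hr1 hn2
  nlinarith [mul_lt_mul_of_pos_left hn1 (pow_pos hr0 2)]

theorem theorem1 (A : ℂ → ℂ) (hA : DifferentiableOn ℂ A (Metric.ball 0 1))
    (ζ : ℂ) (hζ : ζ ∈ Metric.sphere (0 : ℂ) 1) :
    ((∃ c ∈ Set.Ioc (3 : EReal) ⊤, HasBoundaryLimitAlongSeq A ζ c) → HasZeroPairsNear A ζ) ∧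
    (HasZeroPairsNear A ζ → ∃ c ∈ Set.Icc (1 : EReal) ⊤, HasBoundaryLimitAlongSeq A ζ c) := by
  have hζ' : ‖ζ‖ = 1 := by simpa using hζ
  exact ⟨fun ⟨_, hc, h⟩ => h.hasZeroPairsNear hA hζ' hc.1, fun h => h.exists_boundaryLimit hζ'⟩
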